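/- Setting. Let $G=N\rtimes H$ be a semidirect product of (discrete) groups, $M$ a normal subgroup of $N$, $P:=\{a\in H: aMa^{-1}\subseteq M\}$ and $M_a:=aMa^{-1}$ for $a\in P$. Assume - (C1) $H=PP^{-1}=P^{-1}P$; - (C2) $M_a$ has finite index in $M$ for every $a\in P$; - (C3) $\bigcap_{a\in P}M_a=\{e\}$; - $N=\bigcup_{a\in P}a^{-1}Ma$. Let $\mathfrak A$ be the universal unital $C^*$-algebra generated by isometries $s_a$ ($a\in P$) and unitaries $u(m)$ ($m\in M$) subject to $s_as_b=s_{ab}$, $u(m)u(n)=u(mn)$, $s_au(m)=u(ama^{-1})s_a$ and $\sum_{k\in M/M_a}u(k)e_au(k)^{-1}=1$, where $e_a=s_as_a^*$. Let $F$ be the set of projections in the linear span of $\{u(k)e_bu(k)^{-1}:b\in P,k\in M\}$ and let $T:=\{s_a^*u(m)fu(m')s_{a'}: m,m'\in M,\ a,a'\in P,\ f\in F\}$. This is an inverse semigroup of partial isometries containing $0$, with set of projections $F$. The tight groupoid $\mathcal G_{tight}$ of $T$. A character of $F$ is a nonzero multiplicative map $x:F\to\{0,1\}$ with $x(0)=0$;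 characters carry the topology of pointwise convergence. A character is tight if it lies in the closure of the set of characters with maximal support. For $t\in T$ let $D_t=\{x:x(tt^*)=1\}$, and for $x\in D_t$ let $(x.t)(e)=x(tet^*)$. The arrows of $\mathcal G_{tight}$ are the classes $[(x,t)]$ with $x$ tight and $x\in D_t$, where $(x,t)\sim(x',t')$ iff $x=x'$ and $et=et'$ for some $e\in F$ with $x(e)=1$. The range of $[(x,t)]$ is $x$, its source is $x.t$, and the operations are $[(x,t)][(x.t,t')]=[(x,tt')]$ and $[(x,t)]^{-1}=[(x.t,t^*)]$. The topology is the subspace topology from the groupoid of germs over all characters, which is generated by the sets $\{[(x,t)]:x\in U\}$ with $t\in T$ and $U\subseteq D_t$ open. The groupoid $\overline N\rtimes G|_{\overline M}$. Let $\overline M=\{(r_a)\in\prod_{a\in P}M/M_a: r_{ab}\equiv r_a \bmod M_a\}$, a compact group in the product topology of the discrete finite groups $M/M_a$. For $a\in P$ and $r\in\overline M$ define $ara^{-1}\in\overline M$ as follows: its component at $b$ is the image of $r_\alpha$ under the map $M/M_\alpha\to M/M_b$ induced by conjugation by $a$, where $\alpha,\beta\in P$ are chosen with $a\alpha=b\beta$.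 Let $\overline N=(\overline M\times P)/\!\sim$ with the quotient topology ($P$ discrete), where $(x,a)\sim(y,b)$ iff there are $\alpha,\beta\in P$ with $\alpha a=\beta b$ and $\alpha x\alpha^{-1}=\beta y\beta^{-1}$; $\overline M$ is regarded as a subset of $\overline N$ via $x\mapsto[(x,e)]$. The group $G$ acts on $\overline N$ on the left: for $a\in P$, $a\cdot[(x,b)]=[(\beta x\beta^{-1},\alpha)]$ if $\alpha a=\beta b$, and $a^{-1}\cdot[(x,b)]=[(x,ba)]$; for $m\in M$, $m\cdot[(x,a)]=[((ama^{-1})x,a)]$. Put $x.g=g^{-1}\cdot x$. The arrows of $\overline N\rtimes G|_{\overline M}$ are the pairs $(x,g)\in\overline N\times G$ with $x\in\overline M$ and $x.g\in\overline M$, with range $x$, source $x.g$, product $(x,g)(x.g,h)=(x,gh)$, and the subspace topology of $\overline N\times G$ ($G$ discrete). For $r\in\overline M$, also write $r$ for the character whose support is $\{f\in F: f\ge u(r_a)e_au(r_a)^{-1}\text{ for some }a\in P\}$. Theorem. Every $g\in G$ can be written as $g=a^{-1}mb$ with $a,b\in P$ and $m\in M$. The formula $$\phi(x,a^{-1}mb)=[(x,s_a^*u(m)s_b)]$$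 gives a well-defined map $\phi:\overline N\rtimes G|_{\overline M}\to\mathcal G_{tight}$, and $\phi$ is an isomorphism of topological groupoids. -/

import Mathlib

/-- A (small) groupoid with set of arrows `Γ` and set of units `X`. The product `comp g h` is
defined exactly when the source of `g` is the range of `h`. -/
class ArrowGroupoid (Γ : Type*) (X : outParam (Type*)) where
  rng : Γ → X
  src : Γ → X
  one : X → Γ
  inv : Γ → Γ
  comp : (g h : Γ) → src g = rng h → Γ
  rng_one : ∀ x, rng (one x) = x
  src_one : ∀ x, src (one x) = x
  rng_inv : ∀ g, rng (inv g) = src g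
  src_inv : ∀ g, src (inv g) = rng g
  rng_comp : ∀ g h hc, rng (comp g h hc) = rng g
  src_comp : ∀ g h hc, src (comp g h hc) = src h
  one_comp : ∀ g, comp (one (rng g)) g (src_one _) = g
  comp_one : ∀ g, comp g (one (src g)) (rng_one _).symm = g
  comp_inv : ∀ g, comp g (inv g) (rng_inv g).symm = one (rng g)
  inv_comp : ∀ g, comp (inv g) g (src_inv g) = one (src g)
  assoc : ∀ g h k (h₁ : src g = rng h) (h₂ : src h = rng k),
    comp (comp g h h₁) k ((src_comp g h h₁).trans h₂) =
      comp g (comp h k h₂) (h₁.trans (rng_comp h k h₂).symm)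

open ArrowGroupoid in
/-- A topological groupoid: all structure maps are continuous. -/
structure IsTopologicalGroupoid (Γ : Type*) {X : Type*} [ArrowGroupoid Γ X]
    [TopologicalSpace Γ] [TopologicalSpace X] : Prop where
  continuous_rng : Continuous (rng : Γ → X)
  continuous_src : Continuous (src : Γ → X)
  continuous_one : Continuous (one : X → Γ)
  continuous_inv : Continuous (inv : Γ → Γ)
  continuous_comp :
    Continuous fun p : {p : Γ × Γ // src p.1 = rng p.2} => comp p.1.1 p.1.2 p.2

open ArrowGroupoid in
/-- The map `φ` on arrows, together with the map `φ₀` on units, is an isomorphism of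
topological groupoids. -/
structure IsTopologicalGroupoidIso {Γ X Γ' X' : Type*} [ArrowGroupoid Γ X] [ArrowGroupoid Γ' X']
    [TopologicalSpace Γ] [TopologicalSpace X] [TopologicalSpace Γ'] [TopologicalSpace X']
    (φ : Γ → Γ') (φ₀ : X → X') : Prop where
  isHomeomorph : IsHomeomorph φ
  isHomeomorph_units : IsHomeomorph φ₀
  map_rng : ∀ g, rng (φ g) = φ₀ (rng g)
  map_src : ∀ g, src (φ g) = φ₀ (src g)
  map_one : ∀ x, φ (one x) = one (φ₀ x)
  map_inv : ∀ g, φ (inv g) = inv (φ g)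
  map_comp : ∀ g h (hc : src g = rng h) (hc' : src (φ g) = rng (φ h)),
    φ (comp g h hc) = comp (φ g) (φ h) hc'

/-- The arrows of the reduction (restriction) of a groupoid to a set `Y` of units. -/
@[ext]
structure Reduction (Γ : Type*) {X : Type*} [ArrowGroupoid Γ X] (Y : Set X) where
  arrow : Γ
  rng_mem : ArrowGroupoid.rng arrow ∈ Y
  src_mem : ArrowGroupoid.src arrow ∈ Y

namespace Reduction

open ArrowGroupoid

variable {Γ X : Type*} [ArrowGroupoid Γ X] {Y : Set X}

/-- The subspace topology. -/
instance [TopologicalSpace Γ] : TopologicalSpace (Reduction Γ Y) :=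
  TopologicalSpace.induced arrow inferInstance

instance : ArrowGroupoid (Reduction Γ Y) Y where
  rng g := ⟨rng g.arrow, g.rng_mem⟩
  src g := ⟨src g.arrow, g.src_mem⟩
  one x := ⟨one x.1, by rw [rng_one]; exact x.2, by rw [src_one]; exact x.2⟩
  inv g := ⟨inv g.arrow, by rw [rng_inv]; exact g.src_mem, by rw [src_inv]; exact g.rng_mem⟩
  comp g h hc := ⟨comp g.arrow h.arrow (congrArg Subtype.val hc),
    by rw [rng_comp]; exact g.rng_mem, by rw [src_comp]; exact h.src_mem⟩
  rng_one x := Subtype.ext (rng_one _)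
  src_one x := Subtype.ext (src_one _)
  rng_inv g := Subtype.ext (rng_inv _)
  src_inv g := Subtype.ext (src_inv _)
  rng_comp g h _ := Subtype.ext (rng_comp _ _ _)
  src_comp g h _ := Subtype.ext (src_comp _ _ _)
  one_comp g := Reduction.ext (one_comp _)
  comp_one g := Reduction.ext (comp_one _)
  comp_inv g := Reduction.ext (comp_inv _)
  inv_comp g := Reduction.ext (inv_comp _)
  assoc g h k _ _ := Reduction.ext (assoc _ _ _ _ _)

end Reduction

/-- The arrows of the transformation groupoid `X ⋊ G` of a group `G` acting on a space `X`. A left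
action is turned into the right action `x.g = g⁻¹ • x`; then `(x, g)` has range `x` and source
`x.g`, and `(x, g) (x.g, h) = (x, g h)`. -/
@[ext]
structure TransformationGroupoid (X G : Type*) where
  pt : X
  elt : G

namespace TransformationGroupoid

variable {X G : Type*}

/-- The topology of `X ⋊ G`, where `G` is a discrete group. -/
instance [TopologicalSpace X] : TopologicalSpace (TransformationGroupoid X G) :=
  TopologicalSpace.induced (fun g => (g.pt, g.elt)) (@instTopologicalSpaceProd X G _ ⊥)

instance [Group G] [MulAction G X] : ArrowGroupoid (TransformationGroupoid X G) X where
  rng g := g.pt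
  src g := g.elt⁻¹ • g.pt
  one x := ⟨x, 1⟩
  inv g := ⟨g.elt⁻¹ • g.pt, g.elt⁻¹⟩
  comp g h _ := ⟨g.pt, g.elt * h.elt⟩
  rng_one x := rfl
  src_one x := by simp
  rng_inv g := rfl
  src_inv g := by simp
  rng_comp g h _ := rfl
  src_comp g h hc := by
    rw [mul_inv_rev, mul_smul, hc]
  one_comp g := by simp
  comp_one g := by simp
  comp_inv g := by simp
  inv_comp g := by simp
  assoc g h k _ _ := by simp [mul_assoc]

end TransformationGroupoid

/-- An inverse semigroup with zero, in its equational form: a semigroup with an involution `star`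
such that `s s* s = s` and the elements `s s*` commute with each other. Then `star s` is the unique
generalized inverse of `s`, and the idempotents are exactly the projections `e = e* = e²`. -/
class InverseSemigroupWithZero (S : Type*) extends SemigroupWithZero S, StarMul S where
  mul_star_mul_self : ∀ s : S, s * star s * s = s
  mul_star_comm : ∀ s t : S, s * star s * (t * star t) = t * star t * (s * star s)

namespace InverseSemigroupWithZero

variable {S : Type*} [InverseSemigroupWithZero S]

theorem star_zero' : star (0 : S) = 0 := by
  have h := mul_star_mul_self (star (0 : S))
  rw [star_star, mul_zero, zero_mul] at h
  exact h.symm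

variable (S) in
/-- The semilattice `E` of projections of an inverse semigroup. -/
@[ext]
structure Proj where
  val : S
  isStarProjection : IsStarProjection val

theorem proj_comm {e f : S} (he : IsStarProjection e) (hf : IsStarProjection f) :
    e * f = f * e := by
  have h := mul_star_comm e f
  rwa [he.isSelfAdjoint.star_eq, hf.isSelfAdjoint.star_eq, he.isIdempotentElem.eq,
    hf.isIdempotentElem.eq] at h

/-- Every idempotent is a projection. -/
theorem isStarProjection_of_idem {e : S} (he : e * e = e) : IsStarProjection e := by
  have hc := mul_star_comm e (star e)
  rw [star_star] at hc
  have h : e = e * star e * (star e * e) := by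
    calc e = (e * star e * e) * (e * star e * e) := by rw [mul_star_mul_self, he]
      _ = e * (star e * e * (e * star e)) * e := by simp only [mul_assoc]
      _ = e * (e * star e * (star e * e)) * e := by rw [← hc]
      _ = (e * e) * star e * (star e * (e * e)) := by simp only [mul_assoc]
      _ = e * star e * (star e * e) := by rw [he]
  refine ⟨he, ?_⟩
  rw [IsSelfAdjoint]
  conv_lhs => rw [h]
  conv_rhs => rw [h]
  simp only [star_mul, star_star]
  exact hc.symm

/-- `star s` is the unique generalized inverse of `s`. -/
theorem eq_star_of_inverse {s t : S} (h₁ : s * t * s = s) (h₂ : t * s * t = t) : t = star s := by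
  have i₁ : IsStarProjection (s * t) := isStarProjection_of_idem (by rw [← mul_assoc, h₁])
  have i₂ : IsStarProjection (t * s) := isStarProjection_of_idem (by rw [← mul_assoc, h₂])
  have j₁ : s * star s = s * t := by
    have : s * t = s * star s * (s * t) := by rw [← mul_assoc, mul_star_mul_self]
    have h := congrArg star this
    rw [star_mul (s * star s), i₁.isSelfAdjoint.star_eq, star_mul, star_star, ← mul_assoc, h₁] at h
    exact h.symm
  have j₂ : star s * s = t * s := by
    have : t * s = t * s * (star s * s) := by
      rw [mul_assoc, ← mul_assoc s, mul_star_mul_self]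
    have h := congrArg star this
    rw [star_mul (t * s), i₂.isSelfAdjoint.star_eq, star_mul, star_star, mul_assoc, ← mul_assoc s,
      h₁] at h
    exact h.symm
  have k : star s * s * star s = star s := by
    have := mul_star_mul_self (star s); rwa [star_star] at this
  rw [← h₂, ← j₂, mul_assoc, ← j₁, ← mul_assoc, k]

namespace Proj

instance : Mul (Proj S) where
  mul e f := ⟨e.1 * f.1, by
    rw [isStarProjection_iff', star_mul, e.2.isSelfAdjoint.star_eq, f.2.isSelfAdjoint.star_eq]
    refine ⟨?_, proj_comm f.2 e.2⟩
    rw [mul_assoc, ← mul_assoc f.1, proj_comm f.2 e.2, mul_assoc, f.2.isIdempotentElem.eq,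
      ← mul_assoc, e.2.isIdempotentElem.eq]⟩

instance : Zero (Proj S) where
  zero := ⟨0, by rw [isStarProjection_iff']; exact ⟨zero_mul 0, star_zero'⟩⟩

theorem coe_mul (e f : Proj S) : (e * f).1 = e.1 * f.1 := rfl

theorem coe_zero : (0 : Proj S).1 = 0 := rfl

/-- The projection `s s*`. -/
def final (s : S) : Proj S := ⟨s * star s, by
  rw [isStarProjection_iff', star_mul, star_star, ← mul_assoc, mul_star_mul_self]
  exact ⟨rfl, rfl⟩⟩

theorem mul_star_self_mul (s : S) (e : Proj S) : s * star s * (s * e.1) = s * e.1 := by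
  rw [← mul_assoc, mul_star_mul_self]

theorem star_mul_self_comm (s : S) (e : Proj S) : star s * s * e.1 = e.1 * (star s * s) := by
  have := proj_comm (final (star s)).2 e.2
  simpa only [final, star_star] using this

/-- The projection `s e s*`. -/
def conj (s : S) (e : Proj S) : Proj S := ⟨s * e.1 * star s, by
  rw [isStarProjection_iff', star_mul, star_mul, star_star, e.2.isSelfAdjoint.star_eq]
  refine ⟨?_, (mul_assoc _ _ _).symm⟩
  calc s * e.1 * star s * (s * e.1 * star s)
      = s * e.1 * (star s * s * e.1) * star s := by simp only [mul_assoc]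
    _ = s * (e.1 * e.1) * (star s * s * star s) := by
        rw [star_mul_self_comm]; simp only [mul_assoc]
    _ = s * e.1 * star s := by
        have := mul_star_mul_self (star s)
        rw [star_star] at this
        rw [e.2.isIdempotentElem.eq, this]⟩

theorem conj_zero (s : S) : conj s 0 = 0 := by
  apply Proj.ext; simp [conj, coe_zero]

theorem conj_mul (s : S) (e f : Proj S) : conj s (e * f) = conj s e * conj s f := by
  apply Proj.ext
  rw [coe_mul]
  simp only [conj, coe_mul]
  calc s * (e.1 * f.1) * star s = s * e.1 * f.1 * (star s * s * star s) := by
        have := mul_star_mul_self (star s)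
        rw [star_star] at this
        rw [this]; simp only [mul_assoc]
    _ = s * e.1 * (f.1 * (star s * s)) * star s := by simp only [mul_assoc]
    _ = s * e.1 * star s * (s * f.1 * star s) := by
        rw [← star_mul_self_comm]; simp only [mul_assoc]

theorem conj_conj (s t : S) (e : Proj S) : conj s (conj t e) = conj (s * t) e := by
  apply Proj.ext; simp only [conj, star_mul, mul_assoc]

theorem conj_final (s t : S) : conj s (final t) = final (s * t) := by
  apply Proj.ext; simp only [conj, final, star_mul, mul_assoc]

end Proj

variable (S) in
/-- The space of characters of `E`: the nonzero maps `x : E → {0, 1}` that are multiplicative and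
satisfy `x 0 = 0`. -/
@[ext]
structure Character where
  val : Proj S → Bool
  map_mul' : ∀ e f, val (e * f) = (val e && val f)
  map_zero' : val 0 = false
  exists_eq_true : ∃ e, val e = true

namespace Character

/-- The topology of pointwise convergence, inherited from the product `{0, 1}^E`. -/
instance : TopologicalSpace (Character S) :=
  TopologicalSpace.induced Character.val inferInstance

variable (S) in
/-- The maximal characters: those whose support is an ultrafilter. -/
def maximal : Set (Character S) :=
  {x | ∀ y : Character S, (∀ e, x.1 e = true → y.1 e = true) → y = x}

variable (S) in
/-- The tight characters: the closure of the set of maximal characters. -/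
def tight : Set (Character S) := closure (maximal S)

/-- The domain `D_s`. -/
def dom (s : S) : Set (Character S) := {x | x.1 (Proj.final s) = true}

/-- The character `x.s`, where `(x.s)(e) = x(s e s*)`. -/
def act (x : Character S) (s : S) (h : x ∈ dom s) : Character S :=
  ⟨fun e => x.1 (Proj.conj s e), fun e f => by rw [Proj.conj_mul, x.map_mul'],
    by rw [Proj.conj_zero]; exact x.map_zero',
    Proj.final (star s), by
      have : Proj.conj s (Proj.final (star s)) = Proj.final s := by
        apply Proj.ext
        simp only [Proj.conj, Proj.final, star_star]
        rw [← mul_assoc, mul_star_mul_self]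
      rw [this]; exact h⟩

end Character

open Character

variable (S) in
/-- The set `Σ = {(x, s) : x ∈ D_s}`. -/
structure PreGerm where
  pt : Character S
  elt : S
  mem : pt ∈ dom elt

/-- `(x, s) ∼ (y, t)` if `x = y` and `e s = e t` for some projection `e` with `x(e) = 1`. -/
instance PreGerm.setoid : Setoid (PreGerm S) where
  r p q := p.pt = q.pt ∧ ∃ e : Proj S, p.pt.1 e = true ∧ e.1 * p.elt = e.1 * q.elt
  iseqv :=
    { refl := fun p => ⟨rfl, Proj.final p.elt, p.mem, rfl⟩
      symm := by
        rintro p q ⟨h, e, he, h'⟩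
        exact ⟨h.symm, e, h ▸ he, h'.symm⟩
      trans := by
        rintro p q r ⟨h₁, e, he, h₂⟩ ⟨h₃, f, hf, h₄⟩
        refine ⟨h₁.trans h₃, e * f, ?_, ?_⟩
        · rw [Character.map_mul', he, h₁, hf]; rfl
        · rw [Proj.coe_mul, proj_comm e.2 f.2, mul_assoc, h₂, ← mul_assoc, ← proj_comm e.2 f.2, mul_assoc,
            h₄, ← mul_assoc] }

variable (S) in
/-- The arrows of the groupoid `𝒢 = Σ / ∼` of germs. -/
def Germ : Type _ := Quotient (PreGerm.setoid (S := S))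

namespace Germ

/-- The germ `[(x, s)]`. -/
def mk (x : Character S) (s : S) (h : x ∈ dom s) : Germ S := Quotient.mk _ ⟨x, s, h⟩

theorem mk_eq {x : Character S} {s t : S} {hs : x ∈ dom s} {ht : x ∈ dom t} (e : Proj S)
    (he : x.1 e = true) (h : e.1 * s = e.1 * t) : mk x s hs = mk x t ht :=
  Quotient.sound ⟨rfl, e, he, h⟩

theorem exists_rep (g : Germ S) : ∃ x s h, g = mk x s h := by
  induction g using Quotient.inductionOn with
  | _ p => exact ⟨p.pt, p.elt, p.mem, rfl⟩

/-- The range `x` of `[(x, s)]`. -/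
def rng : Germ S → Character S := Quotient.lift PreGerm.pt fun _ _ h => h.1

theorem act_congr {x : Character S} {s t : S} (hs : x ∈ dom s) (ht : x ∈ dom t) (e : Proj S)
    (he : x.1 e = true) (h : e.1 * s = e.1 * t) : x.act s hs = x.act t ht := by
  apply Character.ext
  funext f
  have key : ∀ r : S, x.1 (Proj.conj r f) = x.1 (Proj.conj (e.1 * r) f) := by
    intro r
    rw [← Proj.conj_conj]
    have : Proj.conj e.1 (Proj.conj r f) = e * (Proj.conj r f) * e := by
      apply Proj.ext
      simp only [Proj.conj, Proj.coe_mul, e.2.isSelfAdjoint.star_eq]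
    rw [this, Character.map_mul', Character.map_mul', he]
    simp
  change x.1 (Proj.conj s f) = x.1 (Proj.conj t f)
  rw [key s, key t, h]

/-- The source `x.s` of `[(x, s)]`. -/
def src : Germ S → Character S := Quotient.lift (fun p => p.pt.act p.elt p.mem) (by
  rintro ⟨x, s, hs⟩ ⟨y, t, ht⟩ ⟨h, e, he, h'⟩
  obtain rfl : x = y := h
  exact act_congr hs ht e he h')

theorem rng_mk (x : Character S) (s : S) (h : x ∈ dom s) : rng (mk x s h) = x := rfl

theorem src_mk (x : Character S) (s : S) (h : x ∈ dom s) : src (mk x s h) = x.act s h := rfl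

theorem mem_dom_star {x : Character S} {s : S} (h : x ∈ dom s) : x.act s h ∈ dom (star s) := by
  change x.1 (Proj.conj s (Proj.final (star s))) = true
  rw [Proj.conj_final]
  have : Proj.final (s * star s) = Proj.final s := by
    apply Proj.ext
    simp only [Proj.final, star_mul, star_star]
    rw [← mul_assoc, mul_star_mul_self]
  rw [this]; exact h

theorem mem_dom_mul {x : Character S} {s t : S} (h : x ∈ dom s) (h' : x.act s h ∈ dom t) :
    x ∈ dom (s * t) := by
  change x.1 (Proj.final (s * t)) = true
  rw [← Proj.conj_final]; exact h'

theorem act_mul {x : Character S} {s t : S} (h : x ∈ dom s) (h' : x.act s h ∈ dom t) :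
    (x.act s h).act t h' = x.act (s * t) (mem_dom_mul h h') := by
  apply Character.ext
  funext e
  change x.1 (Proj.conj s (Proj.conj t e)) = x.1 (Proj.conj (s * t) e)
  rw [Proj.conj_conj]

theorem mem_dom_proj {x : Character S} {e : Proj S} (h : x.1 e = true) : x ∈ dom e.1 := by
  change x.1 (Proj.final e.1) = true
  have : Proj.final e.1 = e := by
    apply Proj.ext
    simp only [Proj.final, e.2.isSelfAdjoint.star_eq, e.2.isIdempotentElem.eq]
  rwa [this]

theorem act_proj {x : Character S} {e : Proj S} (h : x.1 e = true) :
    x.act e.1 (mem_dom_proj h) = x := by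
  apply Character.ext
  funext f
  change x.1 (Proj.conj e.1 f) = x.1 f
  have : Proj.conj e.1 f = e * f * e := by
    apply Proj.ext
    simp only [Proj.conj, Proj.coe_mul, e.2.isSelfAdjoint.star_eq]
  rw [this, Character.map_mul', Character.map_mul', h]; simp

/-- The unit `[(x, e)]` at `x`, where `e` is any projection with `x(e) = 1`. -/
noncomputable def one (x : Character S) : Germ S :=
  mk x x.exists_eq_true.choose.1 (mem_dom_proj x.exists_eq_true.choose_spec)

theorem one_eq (x : Character S) (e : Proj S) (h : x.1 e = true) :
    one x = mk x e.1 (mem_dom_proj h) := by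
  refine mk_eq (x.exists_eq_true.choose * e) ?_ ?_
  · rw [Character.map_mul', x.exists_eq_true.choose_spec, h]; rfl
  · have h₁ := x.exists_eq_true.choose.2
    rw [Proj.coe_mul, mul_assoc, mul_assoc, e.2.isIdempotentElem.eq, proj_comm e.2 h₁,
      ← mul_assoc, h₁.isIdempotentElem.eq]

theorem inv_aux {x : Character S} {s t : S} (hs : x ∈ dom s) (ht : x ∈ dom t) (e : Proj S)
    (he : x.1 e = true) (h : e.1 * s = e.1 * t) :
    mk (x.act s hs) (star s) (mem_dom_star hs) = mk (x.act t ht) (star t) (mem_dom_star ht) := by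
  refine Quotient.sound ⟨act_congr hs ht e he h, Proj.conj (star s) e, ?_, ?_⟩
  · change x.1 (Proj.conj s (Proj.conj (star s) e)) = true
    rw [Proj.conj_conj]
    have : Proj.conj (s * star s) e = Proj.final s * e * Proj.final s := by
      apply Proj.ext
      simp only [Proj.conj, Proj.coe_mul, Proj.final, star_mul, star_star]
    rw [this, Character.map_mul', Character.map_mul', he,
      show x.1 (Proj.final s) = true from hs]
    rfl
  · have k : ∀ r : S, star r * e.1 * (r * star r) = star r * e.1 := by
      intro r
      rw [mul_assoc, show e.1 * (r * star r) = r * star r * e.1 from proj_comm e.2 (Proj.final r).2]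
      have := mul_star_mul_self (star r)
      rw [star_star] at this
      rw [← mul_assoc, ← mul_assoc, this]
    have h' : star s * e.1 = star t * e.1 := by
      have := congrArg star h
      rwa [star_mul, star_mul, e.2.isSelfAdjoint.star_eq] at this
    change star s * e.1 * star (star s) * star s = star s * e.1 * star (star s) * star t
    rw [star_star, mul_assoc, k]
    have h2 : star s * e.1 * s = star t * e.1 * t := by rw [h', mul_assoc, h, mul_assoc]
    rw [h2, mul_assoc, k, h']

/-- The inverse `[(x.s, s*)]` of `[(x, s)]`. -/
def inv : Germ S → Germ S :=
  Quotient.lift (fun p => mk (p.pt.act p.elt p.mem) (star p.elt) (mem_dom_star p.mem)) (by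
    rintro ⟨x, s, hs⟩ ⟨y, t, ht⟩ ⟨h, e, he, h'⟩
    obtain rfl : x = y := h
    exact inv_aux hs ht e he h')

theorem inv_mk (x : Character S) (s : S) (h : x ∈ dom s) :
    inv (mk x s h) = mk (x.act s h) (star s) (mem_dom_star h) := rfl

theorem comp_aux {x : Character S} {s s' t t' : S} (hs : x ∈ dom s) (hs' : x ∈ dom s')
    (ht : x.act s hs ∈ dom t) (ht' : x.act s' hs' ∈ dom t')
    (h : mk x s hs = mk x s' hs')
    (h' : mk (x.act s hs) t ht = mk (x.act s' hs') t' ht') :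
    mk x (s * t) (mem_dom_mul hs ht) = mk x (s' * t') (mem_dom_mul hs' ht') := by
  obtain ⟨-, e, he, h₁⟩ := Quotient.exact h
  obtain ⟨-, f, hf, h₂⟩ := Quotient.exact h'
  replace h₁ : e.1 * s = e.1 * s' := h₁
  replace h₂ : f.1 * t = f.1 * t' := h₂
  replace hf : x.1 (Proj.conj s f) = true := hf
  refine mk_eq (e * Proj.conj s f) (by rw [Character.map_mul', he, hf]; rfl) ?_
  have k : ∀ r : S, s * f.1 * star s * (s * r) = s * (f.1 * r) := by
    intro r
    calc s * f.1 * star s * (s * r) = s * (f.1 * (star s * s)) * r := by simp only [mul_assoc]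
      _ = s * (star s * s * f.1) * r := by rw [Proj.star_mul_self_comm]
      _ = s * star s * s * f.1 * r := by simp only [mul_assoc]
      _ = s * (f.1 * r) := by rw [mul_star_mul_self, mul_assoc]
  have c : e.1 * (s * f.1 * star s) = s * f.1 * star s * e.1 := proj_comm e.2 (Proj.conj s f).2
  rw [Proj.coe_mul]
  change e.1 * (s * f.1 * star s) * (s * t) = e.1 * (s * f.1 * star s) * (s' * t')
  have l : e.1 * (s * f.1 * star s) * (s * t) = e.1 * (s * f.1 * star s) * (s * t') := by
    rw [mul_assoc e.1, mul_assoc e.1, k, k, h₂]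
  rw [l, c, mul_assoc _ e.1, mul_assoc _ e.1, ← mul_assoc e.1, ← mul_assoc e.1, h₁]

/-- The product `[(x, s)] [(x.s, t)] = [(x, s t)]`; see `comp_mk`. -/
noncomputable def comp (g h : Germ S) (hc : src g = rng h) : Germ S :=
  mk g.out.pt (g.out.elt * h.out.elt) (mem_dom_mul g.out.mem (by
    have h₁ : src g = g.out.pt.act g.out.elt g.out.mem := by
      conv_lhs => rw [← Quotient.out_eq g]
      rfl
    have h₂ : rng h = h.out.pt := by
      conv_lhs => rw [← Quotient.out_eq h]
      rfl
    rw [← h₁, hc, h₂]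
    exact h.out.mem))

theorem comp_mk (x : Character S) (s t : S) (hs : x ∈ dom s) (ht : x.act s hs ∈ dom t)
    (hc : src (mk x s hs) = rng (mk (x.act s hs) t ht)) :
    comp (mk x s hs) (mk (x.act s hs) t ht) hc = mk x (s * t) (mem_dom_mul hs ht) := by
  have h₁ : Quotient.mk _ (mk x s hs).out = mk x s hs := Quotient.out_eq _
  have h₂ : Quotient.mk _ (mk (x.act s hs) t ht).out = mk (x.act s hs) t ht := Quotient.out_eq _
  unfold comp
  generalize_proofs hp
  revert h₁ h₂ hp
  generalize (mk x s hs).out = p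
  generalize (mk (x.act s hs) t ht).out = q
  obtain ⟨y, s', hs'⟩ := p
  obtain ⟨z, t', ht'⟩ := q
  intro h₁ h₂ hp
  obtain rfl : y = x := congrArg rng h₁
  obtain rfl : z = y.act s hs := congrArg rng h₂
  have h₃ : y.act s' hs' = y.act s hs := congrArg src h₁
  have ht'' : y.act s' hs' ∈ dom t' := h₃ ▸ ht'
  refine comp_aux hs' hs ht'' ht h₁ (Eq.trans ?_ h₂)
  change mk (y.act s' hs') t' ht'' = mk (y.act s hs) t' ht'
  congr 1

noncomputable instance : ArrowGroupoid (Germ S) (Character S) where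
  rng := rng
  src := src
  one := one
  inv := inv
  comp := comp
  rng_one _ := rfl
  src_one x := act_proj x.exists_eq_true.choose_spec
  rng_inv g := by obtain ⟨x, s, h, rfl⟩ := exists_rep g; rfl
  src_inv g := by
    obtain ⟨x, s, h, rfl⟩ := exists_rep g
    rw [inv_mk, src_mk, rng_mk, act_mul]
    exact act_proj (e := Proj.final s) h
  rng_comp g h hc := by
    obtain ⟨x, s, hs, rfl⟩ := exists_rep g
    obtain ⟨y, t, ht, rfl⟩ := exists_rep h
    obtain rfl : x.act s hs = y := hc
    exact (congrArg rng (comp_mk x s t hs ht rfl)).trans rfl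
  src_comp g h hc := by
    obtain ⟨x, s, hs, rfl⟩ := exists_rep g
    obtain ⟨y, t, ht, rfl⟩ := exists_rep h
    obtain rfl : x.act s hs = y := hc
    exact (congrArg src (comp_mk x s t hs ht rfl)).trans (act_mul hs ht).symm
  one_comp g := by
    obtain ⟨x, s, hs, rfl⟩ := exists_rep g
    have h₁ : one x = mk x (Proj.final s).1 (mem_dom_proj hs) := one_eq x (Proj.final s) hs
    have h₂ : x.act (Proj.final s).1 (mem_dom_proj hs) = x := act_proj (e := Proj.final s) hs
    have h₃ : mk x s hs = mk (x.act (Proj.final s).1 (mem_dom_proj hs)) s (h₂.symm ▸ hs) := by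
      congr 1; exact h₂.symm
    have key : ∀ (a b : Germ S) (hc : src a = rng b)
        (ha : a = mk x (Proj.final s).1 (mem_dom_proj hs))
        (hb : b = mk (x.act (Proj.final s).1 (mem_dom_proj hs)) s (h₂.symm ▸ hs)),
        comp a b hc = mk x s hs := by
      rintro _ _ hc rfl rfl
      rw [comp_mk]
      congr 1
      exact mul_star_mul_self s
    exact key _ _ _ h₁ h₃
  comp_one g := by
    obtain ⟨x, s, hs, rfl⟩ := exists_rep g
    have h₀ : (x.act s hs).1 (Proj.final (star s)) = true := mem_dom_star hs
    have key : ∀ (b : Germ S) (hc : src (mk x s hs) = rng b)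
        (hb : b = mk (x.act s hs) (Proj.final (star s)).1 (mem_dom_proj h₀)),
        comp (mk x s hs) b hc = mk x s hs := by
      rintro _ hc rfl
      rw [comp_mk]
      congr 1
      change s * (star s * star (star s)) = s
      rw [star_star, ← mul_assoc, mul_star_mul_self]
    exact key _ _ (one_eq _ _ h₀)
  comp_inv g := by
    obtain ⟨x, s, hs, rfl⟩ := exists_rep g
    have key : ∀ (b : Germ S) (hc : src (mk x s hs) = rng b)
        (hb : b = mk (x.act s hs) (star s) (mem_dom_star hs)),
        comp (mk x s hs) b hc = one x := by
      rintro _ hc rfl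
      rw [comp_mk]
      exact (one_eq x (Proj.final s) hs).symm
    exact key _ _ (inv_mk _ _ _)
  inv_comp g := by
    obtain ⟨x, s, hs, rfl⟩ := exists_rep g
    have h₁ : (x.act s hs).act (star s) (mem_dom_star hs) = x := by
      rw [act_mul]; exact act_proj (e := Proj.final s) hs
    have key : ∀ (b : Germ S) (hc : src (inv (mk x s hs)) = rng b)
        (hb : b = mk ((x.act s hs).act (star s) (mem_dom_star hs)) s (h₁.symm ▸ hs)),
        comp (inv (mk x s hs)) b hc = one (x.act s hs) := by
      rintro _ hc rfl
      refine (comp_mk (x.act s hs) (star s) s (mem_dom_star hs) (h₁.symm ▸ hs) hc).trans ?_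
      rw [one_eq (x.act s hs) (Proj.final (star s)) (mem_dom_star hs)]
      congr 1
      change star s * s = star s * star (star s)
      rw [star_star]
    exact key _ _ (by congr 1; exact h₁.symm)
  assoc g h k h₁ h₂ := by
    obtain ⟨x, s, hs, rfl⟩ := exists_rep g
    obtain ⟨y, t, ht, rfl⟩ := exists_rep h
    obtain ⟨z, r, hr, rfl⟩ := exists_rep k
    obtain rfl : x.act s hs = y := h₁
    obtain rfl : (x.act s hs).act t ht = z := h₂
    have hst := mem_dom_mul hs ht
    have htr := mem_dom_mul ht hr
    have hact : (x.act s hs).act t ht = x.act (s * t) hst := act_mul hs ht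
    have key₁ : ∀ (a b : Germ S) (hc : src a = rng b) (ha : a = mk x (s * t) hst)
        (hb : b = mk (x.act (s * t) hst) r (hact ▸ hr)),
        comp a b hc = mk x (s * t * r) (mem_dom_mul hst (hact ▸ hr)) := by
      rintro _ _ hc rfl rfl
      rw [comp_mk]
    have key₂ : ∀ (b : Germ S) (hc : src (mk x s hs) = rng b)
        (hb : b = mk (x.act s hs) (t * r) htr),
        comp (mk x s hs) b hc = mk x (s * (t * r)) (mem_dom_mul hs htr) := by
      rintro _ hc rfl
      rw [comp_mk]
    refine (key₁ _ _ _ (comp_mk x s t hs ht rfl) (by congr 1)).trans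
      (Eq.trans ?_ (key₂ _ _ (comp_mk (x.act s hs) t r ht hr rfl)).symm)
    congr 1
    exact mul_assoc _ _ _

/-- The topology on germs with basis the sets `θ(s, U) = {[(x, s)] : x ∈ U}`, where `s ∈ S` and
`U ⊆ D_s` is open. -/
instance : TopologicalSpace (Germ S) :=
  TopologicalSpace.generateFrom
    {θ | ∃ (s : S) (U : Set (Character S)) (hU : U ⊆ dom s), IsOpen U ∧
      θ = {g | ∃ (x : Character S) (hx : x ∈ U), g = mk x s (hU hx)}}

end Germ

variable (S) in
/-- The tight groupoid `𝒢_tight`: the reduction of `𝒢` to the set of tight characters. -/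
abbrev TightGroupoid : Type _ := Reduction (Germ S) (tight S)

end InverseSemigroupWithZero


/-- The semigroup `P = {a ∈ H : a M a⁻¹ ⊆ M}` for a subgroup `M` of `N` and an action `θ` of `H` on
`N` by automorphisms; in the semidirect product `N ⋊ H` one has `a m a⁻¹ = θ a m`. -/
def conjSubmonoid {N H : Type*} [Group N] [Group H] (θ : H →* MulAut N) (M : Subgroup N) :
    Submonoid H where
  carrier := {a | ∀ m ∈ M, θ a m ∈ M}
  one_mem' := fun m hm => by simpa using hm
  mul_mem' := fun ha hb m hm => by simpa using ha _ (hb m hm)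

/-- A semidirect product `G = N ⋊ H` together with a normal subgroup `M` of `N` such that, with
`P = {a ∈ H : a M a⁻¹ ⊆ M}`,
(C1) `H = P P⁻¹ = P⁻¹ P`,
(C2) `a M a⁻¹` has finite index in `M` for every `a ∈ P`,
(C3) `⋂_{a ∈ P} a M a⁻¹ = {e}`,
and `N = ⋃_{a ∈ P} a⁻¹ M a`. (In Mathlib an infinite index has the value `0`.) -/
structure CuntzLiPair (N H : Type*) [Group N] [Group H] where
  θ : H →* MulAut N
  M : Subgroup N
  normal : M.Normal
  eq_mul_inv : ∀ h : H, ∃ a ∈ conjSubmonoid θ M, ∃ b ∈ conjSubmonoid θ M, h = a * b⁻¹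
  eq_inv_mul : ∀ h : H, ∃ a ∈ conjSubmonoid θ M, ∃ b ∈ conjSubmonoid θ M, h = a⁻¹ * b
  finite_index : ∀ a ∈ conjSubmonoid θ M, (M.map (θ a).toMonoidHom).relIndex M ≠ 0
  iInf_eq_bot : ⨅ a ∈ conjSubmonoid θ M, M.map (θ a).toMonoidHom = ⊥
  exists_conj_mem : ∀ n : N, ∃ a ∈ conjSubmonoid θ M, θ a n ∈ M

namespace CuntzLiPair

variable {N H : Type*} [Group N] [Group H] (D : CuntzLiPair N H)

/-- The semigroup `P = {a ∈ H : a M a⁻¹ ⊆ M}`. -/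
def P : Submonoid H := conjSubmonoid D.θ D.M

/-- The group `G = N ⋊ H`. -/
abbrev G : Type _ := N ⋊[D.θ] H

/-- The element `a⁻¹ m b` of `G`. -/
def word (a : D.P) (m : D.M) (b : D.P) : D.G :=
  (SemidirectProduct.inr a.1)⁻¹ * SemidirectProduct.inl m.1 * SemidirectProduct.inr b.1

theorem left_reversible (a b : D.P) : ∃ α β : D.P, a * α = b * β := by
  obtain ⟨α, hα, β, hβ, h⟩ := D.eq_mul_inv (a.1⁻¹ * b.1)
  refine ⟨⟨α, hα⟩, ⟨β, hβ⟩, Subtype.ext ?_⟩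
  change a.1 * α = b.1 * β
  rw [eq_mul_inv_iff_mul_eq, mul_assoc, inv_mul_eq_iff_eq_mul] at h
  exact h.symm

theorem right_reversible (a b : D.P) : ∃ α β : D.P, α * a = β * b := by
  obtain ⟨α, hα, β, hβ, h⟩ := D.eq_inv_mul (a.1 * b.1⁻¹)
  refine ⟨⟨α, hα⟩, ⟨β, hβ⟩, Subtype.ext ?_⟩
  change α * a.1 = β * b.1
  rw [eq_inv_mul_iff_mul_eq, ← mul_assoc, mul_inv_eq_iff_eq_mul] at h
  exact h

/-- Conjugation `m ↦ a m a⁻¹` as an endomorphism of `M`, for `a ∈ P`. -/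
def conj (a : D.P) : D.M →* D.M where
  toFun m := ⟨D.θ a.1 m.1, a.2 m.1 m.2⟩
  map_one' := Subtype.ext (map_one (D.θ a.1))
  map_mul' m n := Subtype.ext (map_mul (D.θ a.1) m.1 n.1)

theorem coe_conj (a : D.P) (m : D.M) : (D.conj a m : N) = D.θ a.1 m.1 := rfl

theorem conj_mul (a b : D.P) (m : D.M) : D.conj (a * b) m = D.conj a (D.conj b m) :=
  Subtype.ext (by simp [coe_conj])

theorem conj_one (m : D.M) : D.conj 1 m = m := Subtype.ext (by simp [coe_conj])

theorem conj_injective (a : D.P) : Function.Injective (D.conj a) := fun _ _ h =>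
  Subtype.ext ((D.θ a.1).injective (congrArg Subtype.val h))

/-- The subgroup `M_a = a M a⁻¹` of `M`. -/
def Mₐ (a : D.P) : Subgroup D.M := (D.conj a).range

instance normal_Mₐ (a : D.P) : (D.Mₐ a).Normal where
  conj_mem := by
    rintro _ ⟨n, rfl⟩ m
    refine ⟨⟨(D.θ a.1).symm m.1 * n.1 * ((D.θ a.1).symm m.1)⁻¹,
      D.normal.conj_mem _ n.2 _⟩, Subtype.ext ?_⟩
    simp [coe_conj]

theorem Mₐ_mul_le (a b : D.P) : D.Mₐ (a * b) ≤ D.Mₐ a := by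
  rintro _ ⟨n, rfl⟩
  exact ⟨D.conj b n, (D.conj_mul a b n).symm⟩

theorem Mₐ_mul_le_comap (a b : D.P) : D.Mₐ (a * b) ≤ (D.Mₐ a).comap (MonoidHom.id D.M) :=
  D.Mₐ_mul_le a b

instance finiteIndex_Mₐ (a : D.P) : (D.Mₐ a).FiniteIndex where
  index_ne_zero := by
    have h := D.finite_index a.1 a.2
    have : (D.M.map (D.θ a.1).toMonoidHom).subgroupOf D.M = D.Mₐ a := by
      ext m
      rw [Subgroup.mem_subgroupOf, Subgroup.mem_map]
      constructor
      · rintro ⟨n, hn, h⟩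
        exact ⟨⟨n, hn⟩, Subtype.ext h⟩
      · rintro ⟨n, rfl⟩
        exact ⟨n.1, n.2, rfl⟩
    rwa [Subgroup.relIndex, this] at h

/-- The finite groups `M / M_a` are discrete. -/
instance (a : D.P) : TopologicalSpace (D.M ⧸ D.Mₐ a) := ⊥

/-- The semigroup `P` is discrete. -/
instance : TopologicalSpace D.P := ⊥

/-- `M̄ = {(r_a) ∈ ∏_{a ∈ P} M / M_a : r_{ab} ≡ r_a mod M_a}`, as a subgroup of the product. It
carries the subspace topology of the product topology. -/
def Mbar : Subgroup (∀ a : D.P, D.M ⧸ D.Mₐ a) where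
  carrier := {r | ∀ a b : D.P,
    QuotientGroup.map (D.Mₐ (a * b)) (D.Mₐ a) (MonoidHom.id D.M) (D.Mₐ_mul_le_comap a b)
      (r (a * b)) = r a}
  mul_mem' hx hy a b := by
    rw [Pi.mul_apply, map_mul, hx a b, hy a b]; rfl
  one_mem' a b := map_one _
  inv_mem' hx a b := by
    rw [Pi.inv_apply, map_inv, hx a b]; rfl

/-- The canonical map `M → M̄`. -/
def toMbar : D.M →* D.Mbar where
  toFun m := ⟨fun _ => m, fun _ _ => rfl⟩
  map_one' := rfl
  map_mul' _ _ := rfl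

theorem rep_mul {x : D.Mbar} {a b : D.P} {m : D.M} (h : x.1 (a * b) = m) : x.1 a = m := by
  rw [← x.2 a b, h]; rfl

theorem exists_rep (x : D.Mbar) (a : D.P) : ∃ m : D.M, x.1 a = m :=
  (QuotientGroup.mk_surjective (x.1 a)).imp fun _ h => h.symm

theorem exists_rep₂ (x : D.Mbar) (a b : D.P) : ∃ m : D.M, x.1 a = m ∧ x.1 b = m := by
  obtain ⟨α, β, h⟩ := D.left_reversible a b
  obtain ⟨m, hm⟩ := D.exists_rep x (a * α)
  exact ⟨m, D.rep_mul hm, D.rep_mul (b := β) (by rw [← h]; exact hm)⟩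

theorem conj_mem_of_eq {a b α β : D.P} (h : a * α = b * β) :
    D.Mₐ α ≤ (D.Mₐ b).comap (D.conj a) := by
  rintro _ ⟨n, rfl⟩
  exact ⟨D.conj β n, by rw [← conj_mul, ← conj_mul, h]⟩

/-- The element `a x a⁻¹` of `M̄`, for `a ∈ P` and `x = (x_b) ∈ M̄`. Its component at `b` is the
image of `x_α` under the map `M / M_α → M / M_b` induced by conjugation by `a`, where
`a α = b β`; this does not depend on the choice of `α` and `β` (see `conjBar_apply`). -/
noncomputable def conjBarFun (a : D.P) (x : D.Mbar) (b : D.P) : D.M ⧸ D.Mₐ b :=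
  QuotientGroup.map (D.Mₐ (D.left_reversible a b).choose) (D.Mₐ b) (D.conj a)
    (D.conj_mem_of_eq (D.left_reversible a b).choose_spec.choose_spec)
    (x.1 (D.left_reversible a b).choose)

theorem conjBarFun_apply {a α b β : D.P} (h : a * α = b * β) (x : D.Mbar) {m : D.M}
    (hm : x.1 α = m) : D.conjBarFun a x b = (D.conj a m : D.M) := by
  have key : ∀ γ (hγ : D.Mₐ γ ≤ (D.Mₐ b).comap (D.conj a)),
      QuotientGroup.map (D.Mₐ γ) (D.Mₐ b) (D.conj a) hγ (x.1 γ) = (D.conj a m : D.M) := by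
    intro γ hγ
    obtain ⟨m', h₁, h₂⟩ := D.exists_rep₂ x α γ
    rw [h₂, QuotientGroup.map_mk, QuotientGroup.eq, ← map_inv, ← map_mul]
    apply D.conj_mem_of_eq h
    rw [← QuotientGroup.eq, ← h₁, hm]
  exact key _ _

/-- The map `x ↦ a x a⁻¹` on `M̄`. -/
noncomputable def conjBar (a : D.P) (x : D.Mbar) : D.Mbar :=
  ⟨D.conjBarFun a x, fun b c => by
    obtain ⟨α, β, h⟩ := D.left_reversible a (b * c)
    obtain ⟨m, hm⟩ := D.exists_rep x α
    rw [D.conjBarFun_apply h x hm,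
      D.conjBarFun_apply (β := c * β) (by rw [h, mul_assoc]) x hm]
    rfl⟩

theorem conjBar_apply {a α b β : D.P} (h : a * α = b * β) (x : D.Mbar) {m : D.M}
    (hm : x.1 α = m) : (D.conjBar a x).1 b = (D.conj a m : D.M) :=
  D.conjBarFun_apply h x hm

theorem conjBar_toMbar (a : D.P) (m : D.M) :
    D.conjBar a (D.toMbar m) = D.toMbar (D.conj a m) := by
  apply Subtype.ext
  funext b
  obtain ⟨α, β, h⟩ := D.left_reversible a b
  exact D.conjBar_apply h _ rfl

theorem conjBar_mul (a : D.P) (x y : D.Mbar) :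
    D.conjBar a (x * y) = D.conjBar a x * D.conjBar a y := by
  apply Subtype.ext
  funext b
  obtain ⟨α, β, h⟩ := D.left_reversible a b
  obtain ⟨m, hm⟩ := D.exists_rep x α
  obtain ⟨n, hn⟩ := D.exists_rep y α
  have hmn : (x * y).1 α = ((m * n : D.M) : D.M ⧸ D.Mₐ α) := by
    change x.1 α * y.1 α = _
    rw [hm, hn]; rfl
  rw [D.conjBar_apply h _ hmn]
  change _ = (D.conjBar a x).1 b * (D.conjBar a y).1 b
  rw [D.conjBar_apply h _ hm, D.conjBar_apply h _ hn, map_mul]; rfl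

theorem conjBar_conjBar (a b : D.P) (x : D.Mbar) :
    D.conjBar a (D.conjBar b x) = D.conjBar (a * b) x := by
  apply Subtype.ext
  funext c
  obtain ⟨α, γ, h⟩ := D.left_reversible a c
  obtain ⟨δ, ε, h'⟩ := D.left_reversible b α
  obtain ⟨m, hm⟩ := D.exists_rep x δ
  rw [D.conjBar_apply h _ (D.conjBar_apply h' _ hm),
    D.conjBar_apply (a := a * b) (α := δ) (β := γ * ε) _ _ hm, conj_mul]
  rw [mul_assoc, h', ← mul_assoc, h, mul_assoc]

theorem conjBar_one (x : D.Mbar) : D.conjBar 1 x = x := by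
  apply Subtype.ext
  funext b
  obtain ⟨m, hm⟩ := D.exists_rep x b
  rw [D.conjBar_apply (α := b) (β := 1) (by simp) _ hm, conj_one, hm]

theorem conjBar_injective (a : D.P) : Function.Injective (D.conjBar a) := by
  intro x y h
  apply Subtype.ext
  funext b
  obtain ⟨m, hm⟩ := D.exists_rep x b
  obtain ⟨n, hn⟩ := D.exists_rep y b
  have e : (D.conjBar a x).1 (a * b) = (D.conjBar a y).1 (a * b) := by rw [h]
  rw [D.conjBar_apply (mul_one (a * b)).symm x hm, D.conjBar_apply (mul_one (a * b)).symm y hn,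
    QuotientGroup.eq, ← map_inv, ← map_mul] at e
  obtain ⟨k, hk⟩ := e
  rw [hm, hn, QuotientGroup.eq]
  refine ⟨k, D.conj_injective a ?_⟩
  rw [← conj_mul, hk]

/-- The relation on `M̄ × P`: `(x, a) ∼ (y, b)` if there are `α, β ∈ P` with `α a = β b` and
`α x α⁻¹ = β y β⁻¹`. -/
instance nbarSetoid : Setoid (D.Mbar × D.P) where
  r p q := ∃ α β : D.P, α * p.2 = β * q.2 ∧ D.conjBar α p.1 = D.conjBar β q.1
  iseqv :=
    { refl := fun p => ⟨1, 1, rfl, rfl⟩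
      symm := by
        rintro p q ⟨α, β, h, h'⟩
        exact ⟨β, α, h.symm, h'.symm⟩
      trans := by
        rintro p q r ⟨α, β, h₁, h₂⟩ ⟨γ, δ, h₃, h₄⟩
        obtain ⟨μ, ν, h⟩ := D.right_reversible β γ
        refine ⟨μ * α, ν * δ, ?_, ?_⟩
        · rw [mul_assoc, h₁, ← mul_assoc, h, mul_assoc, h₃, mul_assoc]
        · rw [← conjBar_conjBar, h₂, conjBar_conjBar, h, ← conjBar_conjBar, h₄,
            conjBar_conjBar] }

/-- The space `N̄ = (M̄ × P) / ∼`, with the quotient topology. The class of `(x, a)` plays the role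
of `a⁻¹ x a`. -/
def Nbar : Type _ := Quotient D.nbarSetoid

instance : TopologicalSpace D.Nbar := inferInstanceAs (TopologicalSpace (Quotient D.nbarSetoid))

namespace Nbar

/-- The class `[(x, a)]`. -/
def mk (x : D.Mbar) (a : D.P) : D.Nbar := Quotient.mk D.nbarSetoid (x, a)

variable {D}

theorem mk_eq {x y : D.Mbar} {a b : D.P} (α β : D.P) (h : α * a = β * b)
    (h' : D.conjBar α x = D.conjBar β y) : mk D x a = mk D y b :=
  Quotient.sound ⟨α, β, h, h'⟩

theorem mk_conjBar (c : D.P) (x : D.Mbar) (a : D.P) : mk D (D.conjBar c x) (c * a) = mk D x a :=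
  mk_eq 1 c (one_mul _) (D.conjBar_one _)

theorem exists_smul_rep (g : D.G) (b : D.P) :
    ∃ a c : D.P, ∃ m : D.M, D.θ a.1 g.left = m.1 ∧ a.1 * g.right = c.1 * b.1 := by
  obtain ⟨a, ha, hm⟩ := D.exists_conj_mem g.left
  obtain ⟨c, hc, d, hd, h⟩ := D.eq_inv_mul (g.right * b.1⁻¹)
  obtain ⟨α, β, h'⟩ := D.right_reversible ⟨a, ha⟩ ⟨c, hc⟩
  refine ⟨α * ⟨a, ha⟩, β * ⟨d, hd⟩, D.conj α ⟨_, hm⟩, ?_, ?_⟩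
  · simp [coe_conj]
  · rw [h']
    have : c * g.right = d * b.1 := by
      rw [eq_inv_mul_iff_mul_eq, ← mul_assoc, mul_inv_eq_iff_eq_mul] at h
      exact h
    simp only [Submonoid.coe_mul, mul_assoc, this]

theorem smul_rep_eq {g : D.G} {b b' a a' c c' β β' : D.P} {m m' : D.M} {x x' : D.Mbar}
    (hβ : β * b = β' * b') (hx : D.conjBar β x = D.conjBar β' x')
    (hm : D.θ a.1 g.left = m.1) (hc : a.1 * g.right = c.1 * b.1)
    (hm' : D.θ a'.1 g.left = m'.1) (hc' : a'.1 * g.right = c'.1 * b'.1) :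
    mk D (D.toMbar m * D.conjBar c x) a = mk D (D.toMbar m' * D.conjBar c' x') a' := by
  obtain ⟨μ, ν, h⟩ := D.right_reversible a a'
  have hmm : D.conj μ m = D.conj ν m' := by
    apply Subtype.ext
    rw [coe_conj, coe_conj, ← hm, ← hm', ← MulAut.mul_apply, ← MulAut.mul_apply, ← map_mul,
      ← map_mul]
    exact congrArg (fun t : D.P => D.θ t.1 g.left) h
  have hcc : D.conjBar (μ * c) x = D.conjBar (ν * c') x' := by
    obtain ⟨σ, τ, hs⟩ := D.right_reversible (μ * c) β
    have hs' : σ * (ν * c') = τ * β' := by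
      have e₁ : σ.1 * (μ.1 * c.1) = τ.1 * β.1 := congrArg Subtype.val hs
      have e₂ : β.1 * b.1 = β'.1 * b'.1 := congrArg Subtype.val hβ
      have e₃ : μ.1 * a.1 = ν.1 * a'.1 := congrArg Subtype.val h
      apply Subtype.ext
      change σ.1 * (ν.1 * c'.1) = τ.1 * β'.1
      apply mul_right_cancel (b := b'.1)
      rw [mul_assoc τ.1, ← e₂, ← mul_assoc τ.1, ← e₁]
      simp only [mul_assoc]
      rw [← hc, ← hc', ← mul_assoc μ.1, e₃, mul_assoc]
    have inj : Function.Injective (D.conjBar σ) := D.conjBar_injective σ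
    apply inj
    rw [conjBar_conjBar, conjBar_conjBar, hs, hs', ← conjBar_conjBar, hx, conjBar_conjBar]
  refine mk_eq μ ν h ?_
  rw [conjBar_mul, conjBar_mul, conjBar_toMbar, conjBar_toMbar, conjBar_conjBar, conjBar_conjBar,
    hmm, hcc]

/-- The action of `g ∈ G` on `[(x, b)]`: if `g b⁻¹ = a⁻¹ m c` with `a, c ∈ P` and `m ∈ M`, then
`g [(x, b)] = [(m (c x c⁻¹), a)]`. This does not depend on the choices; see `smul_mk`. -/
noncomputable instance : SMul D.G D.Nbar where
  smul g := Quotient.lift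
    (fun p => mk D (D.toMbar (exists_smul_rep g p.2).choose_spec.choose_spec.choose *
      D.conjBar (exists_smul_rep g p.2).choose_spec.choose p.1) (exists_smul_rep g p.2).choose) (by
    rintro ⟨x, b⟩ ⟨x', b'⟩ ⟨β, β', h, h'⟩
    have h₁ := (exists_smul_rep g b).choose_spec.choose_spec.choose_spec
    have h₂ := (exists_smul_rep g b').choose_spec.choose_spec.choose_spec
    exact smul_rep_eq h h' h₁.1 h₁.2 h₂.1 h₂.2)

theorem smul_mk (g : D.G) (x : D.Mbar) (b a c : D.P) (m : D.M)
    (hm : D.θ a.1 g.left = m.1) (hc : a.1 * g.right = c.1 * b.1) :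
    g • mk D x b = mk D (D.toMbar m * D.conjBar c x) a :=
  have h := (exists_smul_rep g b).choose_spec.choose_spec.choose_spec
  smul_rep_eq (β := 1) (β' := 1) rfl rfl h.1 h.2 hm hc

theorem exists_mk (z : D.Nbar) : ∃ x a, z = mk D x a := by
  induction z using Quotient.inductionOn with
  | _ p => exact ⟨p.1, p.2, rfl⟩

noncomputable instance : MulAction D.G D.Nbar where
  one_smul z := by
    obtain ⟨x, b, rfl⟩ := exists_mk z
    rw [smul_mk 1 x b b 1 1 (by simp) (by simp)]
    rw [map_one, one_mul, conjBar_one]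
  mul_smul g g' z := by
    obtain ⟨x, b, rfl⟩ := exists_mk z
    obtain ⟨a', c', m', hm', hc'⟩ := exists_smul_rep g' b
    obtain ⟨a, c, m, hm, hc⟩ := exists_smul_rep g a'
    rw [smul_mk g' x b a' c' m' hm' hc', smul_mk g _ a' a c m hm hc,
      smul_mk (g * g') x b a (c * c') (m * D.conj c m'), map_mul, ← conjBar_toMbar, mul_assoc,
      ← conjBar_conjBar, ← conjBar_mul]
    · rw [SemidirectProduct.mul_left, map_mul, hm, ← MulAut.mul_apply, ← map_mul, hc, map_mul,
        MulAut.mul_apply, hm']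
      rfl
    · rw [SemidirectProduct.mul_right, ← mul_assoc, hc, mul_assoc, hc', ← mul_assoc]
      rfl

/-- The action of `a ∈ P`, that is, `φ_a [(x, b)] = [(β x β⁻¹, α)]` if `α a = β b`. -/
theorem inr_smul (a b α β : D.P) (h : α * a = β * b) (x : D.Mbar) :
    (SemidirectProduct.inr a.1 : D.G) • mk D x b = mk D (D.conjBar β x) α := by
  rw [smul_mk _ x b α β 1 (by simp) (congrArg Subtype.val h), map_one, one_mul]

/-- The action of `a⁻¹` for `a ∈ P`, that is, `φ_a⁻¹ [(x, b)] = [(x, b a)]`. -/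
theorem inr_inv_smul (a b : D.P) (x : D.Mbar) :
    (SemidirectProduct.inr a.1 : D.G)⁻¹ • mk D x b = mk D x (b * a) := by
  rw [smul_mk _ x b (b * a) 1 1 (by simp) (by simp), map_one, one_mul, conjBar_one]

/-- The action of `m ∈ M`, that is, `ψ_m [(x, a)] = [(a m a⁻¹ x, a)]`. -/
theorem inl_smul (m : D.M) (a : D.P) (x : D.Mbar) :
    (SemidirectProduct.inl m.1 : D.G) • mk D x a = mk D (D.toMbar (D.conj a m) * x) a := by
  rw [smul_mk _ x a a 1 (D.conj a m) rfl (by simp), conjBar_one]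

end Nbar

/-- The inclusion `M̄ → N̄`, `x ↦ [(x, e)]`. -/
def incl (x : D.Mbar) : D.Nbar := Nbar.mk D x 1

/-- The groupoid `N̄ ⋊ G|_{M̄}`. -/
abbrev RestrictedGroupoid : Type _ :=
  Reduction (TransformationGroupoid D.Nbar D.G) (Set.range D.incl)

/-- Isometries `s_a` (`a ∈ P`) and unitaries `u(m)` (`m ∈ M`) in a unital `C*`-algebra `A` that
satisfy the Cuntz-Li relations. Each summand of the last sum depends only on the coset of `k`. -/
structure CuntzLiFamily (A : Type*) [CStarAlgebra A] where
  s : D.P → A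
  u : D.M → A
  star_s_mul_s : ∀ a, star (s a) * s a = 1
  star_u_mul_u : ∀ m, star (u m) * u m = 1
  u_mul_star_u : ∀ m, u m * star (u m) = 1
  s_mul_s : ∀ a b, s a * s b = s (a * b)
  u_mul_u : ∀ m n, u m * u n = u (m * n)
  s_mul_u : ∀ a m, s a * u m = u (D.conj a m) * s a
  sum_eq_one : ∀ a, ∑ᶠ k : D.M ⧸ D.Mₐ a, u k.out * (s a * star (s a)) * star (u k.out) = 1

namespace CuntzLiFamily

variable {D} {A : Type*} [CStarAlgebra A] (v : D.CuntzLiFamily A)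

/-- The projection `u(m) e_a u(m)⁻¹`, where `e_a = s_a s_a*`. -/
noncomputable def proj (m : D.M) (a : D.P) : A := v.u m * (v.s a * star (v.s a)) * star (v.u m)

/-- The linear span `X` of the projections `u(m) e_a u(m)⁻¹`. -/
noncomputable def X : Submodule ℂ A := Submodule.span ℂ {x | ∃ m a, x = v.proj m a}

/-- The set `F` of projections in `X`. -/
def F : Set A := {f | IsStarProjection f ∧ f ∈ v.X}

/-- The set `T` of the elements `s_a* u(m) f u(m') s_{a'}` with `f ∈ F`. -/
def T : Set A :=
  {t | ∃ a m f m' a', f ∈ v.F ∧ t = star (v.s a) * v.u m * f * v.u m' * v.s a'}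

theorem u_one : v.u 1 = 1 := by
  have h := v.u_mul_u 1 1
  rw [mul_one] at h
  calc v.u 1 = star (v.u 1) * v.u 1 * v.u 1 := by rw [v.star_u_mul_u, one_mul]
    _ = 1 := by rw [mul_assoc, h, v.star_u_mul_u]

theorem s_one : v.s 1 = 1 := by
  have h := v.s_mul_s 1 1
  rw [mul_one] at h
  calc v.s 1 = star (v.s 1) * v.s 1 * v.s 1 := by rw [v.star_s_mul_s, one_mul]
    _ = 1 := by rw [mul_assoc, h, v.star_s_mul_s]

theorem star_u (m : D.M) : star (v.u m) = v.u m⁻¹ := by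
  calc star (v.u m) = star (v.u m) * (v.u m * v.u m⁻¹) := by
        rw [v.u_mul_u, mul_inv_cancel, u_one, mul_one]
    _ = v.u m⁻¹ := by rw [← mul_assoc, v.star_u_mul_u, one_mul]

theorem u_mul_star_s (a : D.P) (m : D.M) :
    v.u m * star (v.s a) = star (v.s a) * v.u (D.conj a m) := by
  have h := congrArg star (v.s_mul_u a m⁻¹)
  rwa [star_mul, star_mul, star_u, star_u, inv_inv, ← map_inv, inv_inv] at h

theorem star_s_mul_star_s (a b : D.P) : star (v.s b) * star (v.s a) = star (v.s (a * b)) := by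
  rw [← star_mul, v.s_mul_s]

theorem u_conj (m n : D.M) (a : D.P) : v.u n * v.proj m a * star (v.u n) = v.proj (n * m) a := by
  simp only [proj, ← v.u_mul_u, star_mul, mul_assoc]

theorem s_conj (m : D.M) (a b : D.P) :
    v.s b * v.proj m a * star (v.s b) = v.proj (D.conj b m) (b * a) := by
  simp only [proj]
  rw [star_u, star_u, ← mul_assoc, ← mul_assoc, v.s_mul_u, mul_assoc, v.u_mul_star_s, ← map_inv,
    ← v.s_mul_s, star_mul]
  simp only [mul_assoc]

theorem proj_isStarProjection (m : D.M) (a : D.P) : IsStarProjection (v.proj m a) := by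
  rw [isStarProjection_iff']
  constructor
  · calc v.proj m a * v.proj m a
        = v.u m * (v.s a * (star (v.s a) * ((star (v.u m) * v.u m) * v.s a))) * star (v.s a) *
            star (v.u m) := by simp only [proj, mul_assoc]
      _ = v.proj m a := by
        rw [v.star_u_mul_u, one_mul, v.star_s_mul_s, mul_one]
        simp only [proj, mul_assoc]
  · simp only [proj, star_mul, star_star, mul_assoc]

theorem proj_eq {m n : D.M} {a : D.P} (h : (m : D.M ⧸ D.Mₐ a) = n) : v.proj m a = v.proj n a := by
  rw [QuotientGroup.eq] at h
  obtain ⟨k, hk⟩ := h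
  obtain rfl : n = m * D.conj a k := by rw [hk, mul_inv_cancel_left]
  have h₁ : v.u (D.conj a k) * v.proj 1 a * star (v.u (D.conj a k)) = v.proj 1 a := by
    simp only [proj, u_one, star_one, one_mul, mul_one]
    rw [star_u, ← map_inv, ← mul_assoc, ← v.s_mul_u, mul_assoc, mul_assoc,
      ← v.u_mul_star_s, ← mul_assoc (v.u k), v.u_mul_u, mul_inv_cancel, u_one, one_mul]
  have h₂ := v.u_conj 1 (m * D.conj a k) a
  rw [mul_one] at h₂
  rw [← h₂, ← v.u_mul_u, star_mul]
  calc v.proj m a = v.u m * v.proj 1 a * star (v.u m) := by rw [u_conj, mul_one]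
    _ = v.u m * (v.u (D.conj a k) * v.proj 1 a * star (v.u (D.conj a k))) * star (v.u m) := by
        rw [h₁]
    _ = _ := by simp only [mul_assoc]

theorem sum_proj (a : D.P) [Fintype (D.M ⧸ D.Mₐ a)] :
    ∑ k : D.M ⧸ D.Mₐ a, v.proj k.out a = 1 := by
  rw [← v.sum_eq_one a, finsum_eq_sum_of_fintype]
  rfl

/-- Projections in a `C*`-algebra that add up to `1` are mutually orthogonal. -/
theorem orthogonal_of_sum_eq_one {ι : Type*} [Fintype ι] (p : ι → A)
    (hp : ∀ i, IsStarProjection (p i)) (h : ∑ i, p i = 1) {i j : ι} (hij : i ≠ j) :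
    p i * p j = 0 := by
  classical
  let _ := CStarAlgebra.spectralOrder A
  let _ := CStarAlgebra.spectralOrderedRing A
  have h₁ : ∑ k ∈ Finset.univ.erase i, p i * p k * p i = 0 := by
    have e : ∑ k, p i * p k * p i = p i := by
      rw [← Finset.sum_mul, ← Finset.mul_sum, h, mul_one, (hp i).isIdempotentElem.eq]
    rw [← Finset.add_sum_erase _ _ (Finset.mem_univ i), (hp i).isIdempotentElem.eq,
      (hp i).isIdempotentElem.eq] at e
    exact left_eq_add.1 e.symm
  have h₂ : ∀ k, p i * p k * p i = star (p k * p i) * (p k * p i) := by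
    intro k
    rw [star_mul, (hp i).isSelfAdjoint.star_eq, (hp k).isSelfAdjoint.star_eq, mul_assoc,
      mul_assoc, ← mul_assoc (p k) (p k), (hp k).isIdempotentElem.eq]
  rw [Finset.sum_eq_zero_iff_of_nonneg (fun k _ => by rw [h₂]; exact star_mul_self_nonneg _)] at h₁
  have h₃ := h₁ j (Finset.mem_erase.2 ⟨hij.symm, Finset.mem_univ j⟩)
  rw [h₂, CStarRing.star_mul_self_eq_zero_iff] at h₃
  have h₄ := congrArg star h₃
  rwa [star_mul, star_zero, (hp i).isSelfAdjoint.star_eq, (hp j).isSelfAdjoint.star_eq] at h₄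

theorem proj_mul_of_ne {m n : D.M} {a : D.P} (h : (m : D.M ⧸ D.Mₐ a) ≠ n) :
    v.proj m a * v.proj n a = 0 := by
  have := Fintype.ofFinite (D.M ⧸ D.Mₐ a)
  have k := orthogonal_of_sum_eq_one _ (fun k => v.proj_isStarProjection _ a) (v.sum_proj a) h
  rwa [v.proj_eq (QuotientGroup.out_eq' (m : D.M ⧸ D.Mₐ a)),
    v.proj_eq (QuotientGroup.out_eq' (n : D.M ⧸ D.Mₐ a))] at k

theorem decomposition (m : D.M) (a b : D.P) [Fintype (D.M ⧸ D.Mₐ b)] :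
    v.proj m a = ∑ k : D.M ⧸ D.Mₐ b, v.proj (m * D.conj a k.out) (a * b) := by
  have h : v.proj m a = v.u m * (v.s a * (∑ k : D.M ⧸ D.Mₐ b, v.proj k.out b) * star (v.s a)) *
      star (v.u m) := by
    rw [sum_proj, mul_one]; rfl
  rw [h, Finset.mul_sum, Finset.sum_mul, Finset.mul_sum, Finset.sum_mul]
  refine Finset.sum_congr rfl fun k _ => ?_
  rw [s_conj, u_conj]

/-- The span of the projections `u(m) e_a u(m)⁻¹` for fixed `a`. -/
noncomputable def Xₐ (a : D.P) : Submodule ℂ A := Submodule.span ℂ (Set.range fun m => v.proj m a)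

theorem proj_mem_Xₐ (m : D.M) (a : D.P) : v.proj m a ∈ v.Xₐ a := Submodule.subset_span ⟨m, rfl⟩

theorem proj_mem_X (m : D.M) (a : D.P) : v.proj m a ∈ v.X := Submodule.subset_span ⟨m, a, rfl⟩

theorem Xₐ_le (a : D.P) : v.Xₐ a ≤ v.X := by
  refine Submodule.span_le.2 ?_
  rintro _ ⟨m, rfl⟩
  exact v.proj_mem_X m a

theorem Xₐ_le_mul (a b : D.P) : v.Xₐ a ≤ v.Xₐ (a * b) := by
  have := Fintype.ofFinite (D.M ⧸ D.Mₐ b)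
  refine Submodule.span_le.2 ?_
  rintro _ ⟨m, rfl⟩
  change v.proj m a ∈ _
  rw [v.decomposition m a b]
  exact Submodule.sum_mem _ fun k _ => v.proj_mem_Xₐ _ _

theorem exists_mem_Xₐ {x : A} (hx : x ∈ v.X) : ∃ a, x ∈ v.Xₐ a := by
  induction hx using Submodule.span_induction with
  | mem x h => obtain ⟨m, a, rfl⟩ := h; exact ⟨a, v.proj_mem_Xₐ m a⟩
  | zero => exact ⟨1, Submodule.zero_mem _⟩
  | add x y _ _ hx hy =>
    obtain ⟨a, ha⟩ := hx
    obtain ⟨b, hb⟩ := hy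
    obtain ⟨α, β, h⟩ := D.left_reversible a b
    exact ⟨a * α, Submodule.add_mem _ (v.Xₐ_le_mul a α ha) (h ▸ v.Xₐ_le_mul b β hb)⟩
  | smul c x _ hx =>
    obtain ⟨a, ha⟩ := hx
    exact ⟨a, Submodule.smul_mem _ c ha⟩

theorem mul_mem_Xₐ {a : D.P} {x y : A} (hx : x ∈ v.Xₐ a) (hy : y ∈ v.Xₐ a) :
    x * y ∈ v.Xₐ a ∧ x * y = y * x := by
  induction hx using Submodule.span_induction with
  | zero => rw [zero_mul, mul_zero]; exact ⟨Submodule.zero_mem _, rfl⟩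
  | add x x' _ _ hx hx' =>
    rw [add_mul, mul_add, hx.2, hx'.2]
    exact ⟨Submodule.add_mem _ (hx.2 ▸ hx.1) (hx'.2 ▸ hx'.1), rfl⟩
  | smul c x _ hx =>
    rw [smul_mul_assoc, mul_smul_comm, hx.2]
    exact ⟨Submodule.smul_mem _ c (hx.2 ▸ hx.1), rfl⟩
  | mem x h =>
    obtain ⟨m, rfl⟩ := h
    change v.proj m a * y ∈ _ ∧ v.proj m a * y = y * v.proj m a
    induction hy using Submodule.span_induction with
    | zero => rw [zero_mul, mul_zero]; exact ⟨Submodule.zero_mem _, rfl⟩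
    | add x x' _ _ hx hx' =>
      rw [add_mul, mul_add, hx.2, hx'.2]
      exact ⟨Submodule.add_mem _ (hx.2 ▸ hx.1) (hx'.2 ▸ hx'.1), rfl⟩
    | smul c x _ hx =>
      rw [smul_mul_assoc, mul_smul_comm, hx.2]
      exact ⟨Submodule.smul_mem _ c (hx.2 ▸ hx.1), rfl⟩
    | mem x h =>
      obtain ⟨n, rfl⟩ := h
      change v.proj m a * v.proj n a ∈ _ ∧ v.proj m a * v.proj n a = v.proj n a * v.proj m a
      by_cases hmn : (m : D.M ⧸ D.Mₐ a) = n
      · rw [v.proj_eq hmn, (v.proj_isStarProjection n a).isIdempotentElem.eq]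
        exact ⟨v.proj_mem_Xₐ n a, rfl⟩
      · rw [v.proj_mul_of_ne hmn, v.proj_mul_of_ne (Ne.symm hmn)]
        exact ⟨Submodule.zero_mem _, rfl⟩

theorem mul_mem_X {x y : A} (hx : x ∈ v.X) (hy : y ∈ v.X) : x * y ∈ v.X ∧ x * y = y * x := by
  obtain ⟨a, ha⟩ := v.exists_mem_Xₐ hx
  obtain ⟨b, hb⟩ := v.exists_mem_Xₐ hy
  obtain ⟨α, β, h⟩ := D.left_reversible a b
  have := v.mul_mem_Xₐ (v.Xₐ_le_mul a α ha) (h ▸ v.Xₐ_le_mul b β hb)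
  exact ⟨v.Xₐ_le _ this.1, this.2⟩

theorem u_conj_mem_X (m : D.M) {x : A} (hx : x ∈ v.X) : v.u m * x * star (v.u m) ∈ v.X := by
  induction hx using Submodule.span_induction with
  | mem x h => obtain ⟨n, a, rfl⟩ := h; rw [u_conj]; exact v.proj_mem_X _ _
  | zero => simp
  | add x y _ _ hx hy => rw [mul_add, add_mul]; exact Submodule.add_mem _ hx hy
  | smul c x _ hx => rw [mul_smul_comm, smul_mul_assoc]; exact Submodule.smul_mem _ c hx

theorem s_conj_mem_X (a : D.P) {x : A} (hx : x ∈ v.X) : v.s a * x * star (v.s a) ∈ v.X := by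
  induction hx using Submodule.span_induction with
  | mem x h => obtain ⟨n, b, rfl⟩ := h; rw [s_conj]; exact v.proj_mem_X _ _
  | zero => simp
  | add x y _ _ hx hy => rw [mul_add, add_mul]; exact Submodule.add_mem _ hx hy
  | smul c x _ hx => rw [mul_smul_comm, smul_mul_assoc]; exact Submodule.smul_mem _ c hx

theorem star_s_u_s_eq_zero {m : D.M} {a : D.P} (h : m ∉ D.Mₐ a) :
    star (v.s a) * v.u m * v.s a = 0 := by
  have h₁ : v.proj 1 a * v.proj m a = 0 := by
    apply v.proj_mul_of_ne
    rw [Ne, QuotientGroup.eq, inv_one, one_mul]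
    exact h
  calc star (v.s a) * v.u m * v.s a
      = (star (v.s a) * v.s a) * (star (v.s a) * v.u m * v.s a) *
          ((star (v.s a)) * (star (v.u m) * v.u m) * v.s a) := by
        rw [v.star_u_mul_u, mul_one, v.star_s_mul_s, one_mul, mul_one]
    _ = star (v.s a) * (v.proj 1 a * v.proj m a) * (v.u m * v.s a) := by
        simp only [proj, u_one, star_one, one_mul, mul_one, mul_assoc]
    _ = 0 := by rw [h₁, mul_zero, zero_mul]

theorem star_s_conj_mem_X (a : D.P) {x : A} (hx : x ∈ v.X) : star (v.s a) * x * v.s a ∈ v.X := by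
  obtain ⟨b, hb⟩ := v.exists_mem_Xₐ hx
  obtain ⟨α, β, h⟩ := D.left_reversible a b
  replace hb : x ∈ v.Xₐ (a * α) := h ▸ v.Xₐ_le_mul b β hb
  clear hx h
  induction hb using Submodule.span_induction with
  | zero => simp
  | add x y _ _ hx hy => rw [mul_add, add_mul]; exact Submodule.add_mem _ hx hy
  | smul c x _ hx => rw [mul_smul_comm, smul_mul_assoc]; exact Submodule.smul_mem _ c hx
  | mem x hx =>
    obtain ⟨m, rfl⟩ := hx
    change star (v.s a) * v.proj m (a * α) * v.s a ∈ _
    by_cases hm : m ∈ D.Mₐ a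
    · obtain ⟨k, rfl⟩ := hm
      rw [← s_conj]
      have : star (v.s a) * (v.s a * v.proj k α * star (v.s a)) * v.s a = v.proj k α := by
        calc _ = (star (v.s a) * v.s a) * v.proj k α * (star (v.s a) * v.s a) := by
              simp only [mul_assoc]
          _ = v.proj k α := by rw [v.star_s_mul_s, one_mul, mul_one]
      rw [this]
      exact v.proj_mem_X k α
    · have : star (v.s a) * v.proj m (a * α) * v.s a = 0 := by
        calc _ = (star (v.s a) * v.u m * v.s a) *
              (v.s α * star (v.s (a * α)) * star (v.u m) * v.s a) := by
              simp only [proj, ← v.s_mul_s, mul_assoc]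
          _ = 0 := by rw [v.star_s_u_s_eq_zero hm, zero_mul]
      rw [this]
      exact Submodule.zero_mem _

theorem mul_mem_F {e f : A} (he : e ∈ v.F) (hf : f ∈ v.F) : e * f ∈ v.F := by
  have h := v.mul_mem_X he.2 hf.2
  refine ⟨?_, h.1⟩
  rw [isStarProjection_iff', star_mul, he.1.isSelfAdjoint.star_eq, hf.1.isSelfAdjoint.star_eq]
  refine ⟨?_, h.2.symm⟩
  rw [mul_assoc, ← mul_assoc f, ← h.2, mul_assoc, hf.1.isIdempotentElem.eq, ← mul_assoc,
    he.1.isIdempotentElem.eq]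

theorem proj_mem_F (m : D.M) (a : D.P) : v.proj m a ∈ v.F :=
  ⟨v.proj_isStarProjection m a, v.proj_mem_X m a⟩

theorem isometry_conj {w f : A} (hw : star w * w = 1) (hf : IsStarProjection f) :
    IsStarProjection (w * f * star w) := by
  rw [isStarProjection_iff']
  constructor
  · calc _ = w * f * (star w * w) * f * star w := by simp only [mul_assoc]
      _ = _ := by rw [hw, mul_one, mul_assoc w, hf.isIdempotentElem.eq]
  · simp only [star_mul, star_star, hf.isSelfAdjoint.star_eq, mul_assoc]

theorem u_conj_mem_F (m : D.M) {f : A} (hf : f ∈ v.F) : v.u m * f * star (v.u m) ∈ v.F :=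
  ⟨isometry_conj (v.star_u_mul_u m) hf.1, v.u_conj_mem_X m hf.2⟩

theorem s_conj_mem_F (a : D.P) {f : A} (hf : f ∈ v.F) : v.s a * f * star (v.s a) ∈ v.F :=
  ⟨isometry_conj (v.star_s_mul_s a) hf.1, v.s_conj_mem_X a hf.2⟩

theorem star_s_conj_mem_F (a : D.P) {f : A} (hf : f ∈ v.F) :
    star (v.s a) * f * v.s a ∈ v.F := by
  refine ⟨?_, v.star_s_conj_mem_X a hf.2⟩
  rw [isStarProjection_iff']
  constructor
  · have hc : f * v.proj 1 a = v.proj 1 a * f := (v.mul_mem_X hf.2 (v.proj_mem_X 1 a)).2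
    calc star (v.s a) * f * v.s a * (star (v.s a) * f * v.s a)
        = star (v.s a) * (f * v.proj 1 a) * f * v.s a := by
          simp only [proj, u_one, star_one, one_mul, mul_one, mul_assoc]
      _ = (star (v.s a) * v.s a) * star (v.s a) * (f * f) * v.s a := by
          rw [hc]; simp only [proj, u_one, star_one, one_mul, mul_one, mul_assoc]
      _ = _ := by rw [v.star_s_mul_s, one_mul, hf.1.isIdempotentElem.eq]
  · simp only [star_mul, star_star, hf.1.isSelfAdjoint.star_eq, mul_assoc]

/-- A normal form for the elements of `T`. -/
theorem mem_T_iff {t : A} :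
    t ∈ v.T ↔ ∃ a f m b, f ∈ v.F ∧ t = star (v.s a) * f * v.u m * v.s b := by
  constructor
  · rintro ⟨a, m, f, n, b, hf, rfl⟩
    refine ⟨a, _, m * n, b, v.u_conj_mem_F m hf, ?_⟩
    calc _ = star (v.s a) * v.u m * f * (star (v.u m) * v.u m) * v.u n * v.s b := by
          rw [v.star_u_mul_u, mul_one]
      _ = _ := by rw [← v.u_mul_u]; simp only [mul_assoc]
  · rintro ⟨a, f, m, b, hf, rfl⟩
    exact ⟨a, 1, f, m, b, hf, by rw [u_one, mul_one]⟩

theorem star_mem_T {t : A} (ht : t ∈ v.T) : star t ∈ v.T := by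
  obtain ⟨a, m, f, n, b, hf, rfl⟩ := ht
  refine ⟨b, n⁻¹, f, m⁻¹, a, hf, ?_⟩
  simp only [star_mul, star_star, hf.1.isSelfAdjoint.star_eq, star_u, mul_assoc]

theorem mul_mem_T {t t' : A} (ht : t ∈ v.T) (ht' : t' ∈ v.T) : t * t' ∈ v.T := by
  rw [mem_T_iff] at ht ht' ⊢
  obtain ⟨a, f, m, b, hf, rfl⟩ := ht
  obtain ⟨c, g, n, d, hg, rfl⟩ := ht'
  obtain ⟨α, β, h⟩ := D.right_reversible b c
  have h₁ : v.s b * star (v.s c) = star (v.s α) * v.proj 1 (α * b) * v.s β := by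
    calc v.s b * star (v.s c)
        = (star (v.s α) * v.s α) * (v.s b * star (v.s c)) * (star (v.s β) * v.s β) := by
          rw [v.star_s_mul_s, v.star_s_mul_s, one_mul, mul_one]
      _ = star (v.s α) * (v.s (α * b) * star (v.s (β * c))) * v.s β := by
          rw [← v.s_mul_s, ← v.s_mul_s, star_mul]; simp only [mul_assoc]
      _ = _ := by rw [← h]; simp only [proj, u_one, star_one, one_mul, mul_one]
  have h₂ : v.u m * star (v.s α) = star (v.s α) * v.u (D.conj α m) := v.u_mul_star_s α m
  have h₃ : f * star (v.s α) = star (v.s α) * (v.s α * f * star (v.s α)) := by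
    rw [← mul_assoc, ← mul_assoc, v.star_s_mul_s, one_mul]
  have h₄ : v.s β * g = (v.s β * g * star (v.s β)) * v.s β := by
    rw [mul_assoc _ (star (v.s β)), v.star_s_mul_s, mul_one]
  have h₅ : v.s β * v.u n = v.u (D.conj β n) * v.s β := v.s_mul_u β n
  set f' := v.s α * f * star (v.s α) with hf'
  set g' := v.s β * g * star (v.s β) with hg'
  set p := v.proj 1 (α * b) with hp
  have hF : p * g' ∈ v.F := v.mul_mem_F (v.proj_mem_F _ _) (v.s_conj_mem_F β hg)
  have h₆ : v.u (D.conj α m) * (p * g') =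
      v.u (D.conj α m) * (p * g') * star (v.u (D.conj α m)) * v.u (D.conj α m) := by
    rw [mul_assoc _ (star (v.u (D.conj α m))), v.star_u_mul_u, mul_one]
  refine ⟨α * a, f' * (v.u (D.conj α m) * (p * g') * star (v.u (D.conj α m))),
    D.conj α m * D.conj β n, β * d,
    v.mul_mem_F (v.s_conj_mem_F α hf) (v.u_conj_mem_F _ hF), ?_⟩
  calc star (v.s a) * f * v.u m * v.s b * (star (v.s c) * g * v.u n * v.s d)
      = star (v.s a) * f * v.u m * (v.s b * star (v.s c)) * g * v.u n * v.s d := by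
        simp only [mul_assoc]
    _ = star (v.s a) * f * (v.u m * star (v.s α)) * p * (v.s β * g) * v.u n * v.s d := by
        rw [h₁]; simp only [mul_assoc]
    _ = star (v.s a) * (f * star (v.s α)) * v.u (D.conj α m) * p * g' * (v.s β * v.u n) * v.s d := by
        rw [h₂, h₄]; simp only [mul_assoc]
    _ = (star (v.s a) * star (v.s α)) * f' * (v.u (D.conj α m) * (p * g')) * v.u (D.conj β n) *
          (v.s β * v.s d) := by
        rw [h₃, h₅]; simp only [mul_assoc]
    _ = _ := by
        conv_lhs => rw [h₆]
        rw [v.star_s_mul_star_s, v.s_mul_s, ← v.u_mul_u]; simp only [mul_assoc]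

theorem zero_mem_T : (0 : A) ∈ v.T :=
  ⟨1, 1, 0, 1, 1, ⟨IsStarProjection.zero A, Submodule.zero_mem _⟩, by simp⟩

theorem mul_star_mem_F {t : A} (ht : t ∈ v.T) : t * star t ∈ v.F := by
  rw [mem_T_iff] at ht
  obtain ⟨a, f, m, b, hf, rfl⟩ := ht
  have : star (v.s a) * f * v.u m * v.s b * star (star (v.s a) * f * v.u m * v.s b) =
      star (v.s a) * (f * (v.proj m b) * f) * v.s a := by
    simp only [proj, star_mul, star_star, hf.1.isSelfAdjoint.star_eq, mul_assoc]
  rw [this]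
  exact v.star_s_conj_mem_F a (v.mul_mem_F (v.mul_mem_F hf (v.proj_mem_F m b)) hf)

theorem mul_star_mul_self_of_mem_T {t : A} (ht : t ∈ v.T) : t * star t * t = t := by
  have hp := (v.mul_star_mem_F ht).1
  set q := t * star t with hq
  have h : (q * t - t) * star (q * t - t) = 0 := by
    calc _ = q * (t * star t) * star q - q * (t * star t) - (t * star t) * star q + t * star t := by
          rw [star_sub, star_mul]; noncomm_ring
      _ = 0 := by
          rw [← hq, hp.isSelfAdjoint.star_eq, hp.isIdempotentElem.eq, hp.isIdempotentElem.eq]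
          noncomm_ring
  rw [CStarRing.mul_star_self_eq_zero_iff] at h
  exact sub_eq_zero.1 h

/-- `T` is an inverse semigroup with zero, with the operations of the `C*`-algebra. -/
noncomputable instance : InverseSemigroupWithZero v.T where
  mul t t' := ⟨t.1 * t'.1, v.mul_mem_T t.2 t'.2⟩
  mul_assoc _ _ _ := Subtype.ext (mul_assoc _ _ _)
  zero := ⟨0, v.zero_mem_T⟩
  zero_mul _ := Subtype.ext (zero_mul _)
  mul_zero _ := Subtype.ext (mul_zero _)
  star t := ⟨star t.1, v.star_mem_T t.2⟩
  star_involutive _ := Subtype.ext (star_star _)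
  star_mul _ _ := Subtype.ext (star_mul _ _)
  mul_star_mul_self t := Subtype.ext (v.mul_star_mul_self_of_mem_T t.2)
  mul_star_comm t t' := Subtype.ext
    (v.mul_mem_X (v.mul_star_mem_F t.2).2 (v.mul_star_mem_F t'.2).2).2

/-- The element `s_a* u(m) s_b` of `T`. -/
noncomputable def elt (a : D.P) (m : D.M) (b : D.P) : v.T :=
  ⟨star (v.s a) * v.u m * v.s b, a, m, v.proj 1 1, 1, b, v.proj_mem_F 1 1, by
    simp [proj, u_one, s_one]⟩

end CuntzLiFamily

section universal

universe u v

variable {N : Type u} {H : Type v} [Group N] [Group H] (D : CuntzLiPair N H)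

/-- A realization of the Cuntz-Li relations in some nonzero unital `C*`-algebra. -/
structure Realization where
  carrier : Type (max u v)
  [cstar : CStarAlgebra carrier]
  [nontrivial : Nontrivial carrier]
  family : D.CuntzLiFamily carrier

attribute [instance] Realization.cstar Realization.nontrivial

open scoped ENNReal in
/-- The `C*`-algebra of bounded families `(x_i)` indexed by all realizations `i` of the Cuntz-Li
relations, with the supremum norm. -/
abbrev BigProduct : Type _ := lp (fun i : Realization D => i.carrier) ∞

noncomputable instance instCStarAlgebraBigProduct : CStarAlgebra (BigProduct D) where

theorem norm_le_one_of_isometry {B : Type*} [CStarAlgebra B] {w : B} (h : star w * w = 1) :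
    ‖w‖ ≤ 1 := by
  have h₁ := CStarRing.norm_star_mul_self (x := w)
  rw [h] at h₁
  by_contra! h₂
  have h₃ : ‖(1 : B)‖ ≤ 1 := by
    rcases subsingleton_or_nontrivial B with hB | hB
    · rw [Subsingleton.elim (1 : B) 0, norm_zero]; exact zero_le_one
    · rw [CStarRing.norm_one]
  nlinarith

open scoped ENNReal in
theorem memℓp_of_isometry (f : ∀ i : Realization D, i.carrier)
    (h : ∀ i, star (f i) * f i = 1) : Memℓp f ∞ :=
  memℓp_infty ⟨1, by rintro _ ⟨i, rfl⟩; exact norm_le_one_of_isometry (h i)⟩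

/-- The family of all `s_a`, respectively of all `u(m)`, in the product of all realizations. -/
noncomputable def bigFamily : D.CuntzLiFamily (BigProduct D) where
  s a := ⟨fun i => i.family.s a, D.memℓp_of_isometry _ fun i => i.family.star_s_mul_s a⟩
  u m := ⟨fun i => i.family.u m, D.memℓp_of_isometry _ fun i => i.family.star_u_mul_u m⟩
  star_s_mul_s a := by ext i; exact i.family.star_s_mul_s a
  star_u_mul_u m := by ext i; exact i.family.star_u_mul_u m
  u_mul_star_u m := by ext i; exact i.family.u_mul_star_u m
  s_mul_s a b := by ext i; exact i.family.s_mul_s a b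
  u_mul_u m n := by ext i; exact i.family.u_mul_u m n
  s_mul_u a m := by ext i; exact i.family.s_mul_u a m
  sum_eq_one a := by
    have := Fintype.ofFinite (D.M ⧸ D.Mₐ a)
    rw [finsum_eq_sum_of_fintype]
    ext i
    have h := i.family.sum_eq_one a
    rw [finsum_eq_sum_of_fintype] at h
    rw [lp.coeFn_sum, Finset.sum_apply]
    exact h

/-- The universal `C*`-algebra of the Cuntz-Li relations is constructed as the `C*`-subalgebra
generated by the universal family in the product of all realizations. (A `C*`-algebra generated
by a family indexed by `P` and `M` has at most `max(|N|, |H|, ℵ₀) ^ ℵ₀` elements, so it has an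
isomorphic copy in `Type (max u v)`; hence no realization is missed. The universal property is
`exists_starAlgHom` below.) -/
noncomputable def universalSubalgebra : StarSubalgebra ℂ (BigProduct D) :=
  (StarAlgebra.adjoin ℂ (Set.range D.bigFamily.s ∪ Set.range D.bigFamily.u)).topologicalClosure

theorem subset_universalSubalgebra :
    Set.range D.bigFamily.s ∪ Set.range D.bigFamily.u ⊆ (D.universalSubalgebra : Set D.BigProduct) :=
  (StarAlgebra.subset_adjoin ℂ _).trans (StarSubalgebra.le_topologicalClosure _)

/-- The universal `C*`-algebra `𝔄[N ⋊ H, M]`. -/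
abbrev UniversalAlgebra : Type _ := D.universalSubalgebra

noncomputable instance : CStarAlgebra D.UniversalAlgebra :=
  StarSubalgebra.cstarAlgebra D.universalSubalgebra
    (h_closed := StarSubalgebra.isClosed_topologicalClosure _)

/-- The generators `s_a` and `u(m)` of `𝔄[N ⋊ H, M]`. -/
noncomputable def universalFamily : D.CuntzLiFamily D.UniversalAlgebra where
  s a := ⟨D.bigFamily.s a, D.subset_universalSubalgebra (Or.inl ⟨a, rfl⟩)⟩
  u m := ⟨D.bigFamily.u m, D.subset_universalSubalgebra (Or.inr ⟨m, rfl⟩)⟩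
  star_s_mul_s a := Subtype.ext (D.bigFamily.star_s_mul_s a)
  star_u_mul_u m := Subtype.ext (D.bigFamily.star_u_mul_u m)
  u_mul_star_u m := Subtype.ext (D.bigFamily.u_mul_star_u m)
  s_mul_s a b := Subtype.ext (D.bigFamily.s_mul_s a b)
  u_mul_u m n := Subtype.ext (D.bigFamily.u_mul_u m n)
  s_mul_u a m := Subtype.ext (D.bigFamily.s_mul_u a m)
  sum_eq_one a := by
    have := Fintype.ofFinite (D.M ⧸ D.Mₐ a)
    have h := D.bigFamily.sum_eq_one a
    rw [finsum_eq_sum_of_fintype] at h ⊢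
    apply Subtype.ext
    rw [AddSubmonoidClass.coe_finsetSum]
    exact h

/-- The universal property: every realization of the relations is the image of the universal family
under a `*`-homomorphism. -/
theorem exists_starAlgHom (R : D.Realization) : ∃ π : D.UniversalAlgebra →⋆ₐ[ℂ] R.carrier,
    (∀ a, π (D.universalFamily.s a) = R.family.s a) ∧
      ∀ m, π (D.universalFamily.u m) = R.family.u m :=
  ⟨{ toFun := fun x => x.1.1 R
     map_one' := rfl
     map_mul' := fun _ _ => rfl
     map_zero' := rfl
     map_add' := fun _ _ => rfl
     commutes' := fun _ => rfl
     map_star' := fun _ => rfl }, fun _ => rfl, fun _ => rfl⟩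

/-- The inverse semigroup `T` of partial isometries in `𝔄[N ⋊ H, M]`. -/
abbrev T : Type _ := D.universalFamily.T

/-- The indicator function of `A_r = {f ∈ F : f ≥ u(r_a) e_a u(r_a)⁻¹ for some a ∈ P}` on the
projections of `T`, for `r ∈ M̄`, as a relation: `χ` is the character with support `A_r`. -/
def IsCharacterOf (r : D.Mbar) (χ : InverseSemigroupWithZero.Character D.T) : Prop :=
  ∀ f : InverseSemigroupWithZero.Proj D.T, χ.val f = true ↔
    ∃ (a : D.P) (m : D.M), r.1 a = m ∧
      f.val.1 * D.universalFamily.proj m a = D.universalFamily.proj m a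

end universal

end CuntzLiPair

/-! Units. For fixed $a$ the projections $u(m)e_au(m)^{-1}$ depend only on the coset of $m$ in the
finite group $M/M_a$; they are mutually orthogonal with sum $1$, and passing from $a$ to $ab$
refines them. So each $f\in F$ is a sum of such projections at some level $a$. An ultrafilter of $F$
selects exactly one coset at every level, compatibly, which is a point of $\overline M$
(`exists_projT_of_mem_maximal`, `exists_eq_char`); conversely every point of $\overline M$ gives a
maximal character. Selecting a coset at every level is a closed condition because $M/M_a$ is finite,
so the closure adds nothing and the tight characters are exactly $\overline M$, with the same
topology (`tight_eq_range_char`, `isEmbedding_char`).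

Arrows. Reduction to a common denominator shows that $t_g=s_a^*u(m)s_b$ depends only on $g=a^{-1}mb$
(`elt_eq_of_word_eq`). The $t_g$ form a partial representation, $t_gt_g^*t_{gh}=t_gt_h$ and
$t_{g^{-1}}=t_g^*$, and each element of $T$ has the form $ft_g$ with $f\in F$ (`ofGroup_mul`,
`exists_eq_mul_ofGroup`). A computation with conjugations identifies the partial action of $t_g$ on
characters with that of $g^{-1}$ on $\overline M\subseteq\overline N$ (`char_mem_dom_ofGroup_iff`,
`act_char`). This makes $\phi$ a well-defined surjective homomorphism. It is continuous and open
because $G$ is discrete and $\overline M$ is open in $\overline N$.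

Injectivity says that the germ of $t_g$ at $x$ determines $g$. Here the universal property enters:
$\mathfrak A$ is represented on $\ell^2(M\times H)$, where $M\times H\subseteq G$ is stable under
left multiplication by $P$ and $M$, and $t_g$ acts as a restriction of left translation by $g$. One
unit vector on which $t_g^*$ does not vanish then reveals $g$ (`word_eq_word_of_star_mul_proj_eq`).
The same representation shows $\mathfrak A\ne0$, without which no projection would be known to be
nonzero. -/

/-- The unit vector at `i` in `ℓ²(ι)`. -/
noncomputable def ellTwoVec {ι : Type*} (i : ι) : lp (fun _ : ι => ℂ) 2 :=
  open Classical in lp.single 2 i 1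

/-! ### Isometries of $\ell^2$ induced by injections of the index set. -/

section EllTwo

variable {ι : Type*}

theorem inner_ellTwoVec_left (i : ι) (x : lp (fun _ : ι => ℂ) 2) :
    inner ℂ (ellTwoVec i) x = x i := by
  classical
  rw [ellTwoVec, Subsingleton.elim (fun a b => Classical.propDecidable (a = b)) _,
    lp.inner_single_left]
  simp

open Classical in
theorem ellTwoVec_apply (i j : ι) : ellTwoVec i j = if j = i then (1 : ℂ) else 0 := by
  rw [ellTwoVec, lp.single_apply]
  simp [Pi.single_apply]

theorem ellTwoVec_ne_zero (i : ι) : ellTwoVec i ≠ 0 := by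
  intro h
  have := congrArg (fun x : lp (fun _ : ι => ℂ) 2 => x i) h
  simp [ellTwoVec_apply] at this

theorem orthonormal_ellTwoVec : Orthonormal ℂ (ellTwoVec (ι := ι)) := by
  classical
  rw [orthonormal_iff_ite]
  intro i j
  rw [inner_ellTwoVec_left, ellTwoVec_apply]

/-- The exponent $2$ is finite, so the unit vectors span a dense subspace. -/
theorem ellTwo_clm_ext {f g : lp (fun _ : ι => ℂ) 2 →L[ℂ] lp (fun _ : ι => ℂ) 2}
    (h : ∀ i, f (ellTwoVec i) = g (ellTwoVec i)) : f = g := by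
  classical
  refine lp.ext_continuousLinearMap (ENNReal.ofNat_ne_top (n := nat_lit 2)) fun i => ?_
  ext1
  convert h i using 2 <;> simp [ellTwoVec]

/-- The isometry of `ℓ²(ι)` that maps the unit vector at `i` to the one at `f i`. -/
noncomputable def ellTwoShift (f : ι ↪ ι) :
    lp (fun _ : ι => ℂ) 2 →L[ℂ] lp (fun _ : ι => ℂ) 2 :=
  (orthonormal_ellTwoVec.comp f f.injective).orthogonalFamily.linearIsometry.toContinuousLinearMap

theorem ellTwoShift_apply (f : ι ↪ ι) (i : ι) :
    ellTwoShift f (ellTwoVec i) = ellTwoVec (f i) := by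
  classical
  rw [ellTwoShift, LinearIsometry.coe_toContinuousLinearMap]
  conv_lhs => enter [2]; rw [ellTwoVec]
  rw [Subsingleton.elim (fun a b => Classical.propDecidable (a = b)) _,
    OrthogonalFamily.linearIsometry_apply_single]
  simp

open Classical in
theorem star_ellTwoShift_apply_apply (f : ι ↪ ι) (j k : ι) :
    star (ellTwoShift f) (ellTwoVec j) k = if f k = j then 1 else 0 := by
  rw [← inner_ellTwoVec_left, ContinuousLinearMap.star_eq_adjoint,
    ContinuousLinearMap.adjoint_inner_right, ellTwoShift_apply, inner_ellTwoVec_left,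
    ellTwoVec_apply]

theorem star_ellTwoShift_apply_apply_ne_zero_iff (f : ι ↪ ι) (j k : ι) :
    star (ellTwoShift f) (ellTwoVec j) k ≠ 0 ↔ f k = j := by
  rw [star_ellTwoShift_apply_apply]
  split_ifs <;> simp [*]

theorem star_ellTwoShift_apply (f : ι ↪ ι) (i : ι) :
    star (ellTwoShift f) (ellTwoVec (f i)) = ellTwoVec i := by
  ext k
  rw [star_ellTwoShift_apply_apply, ellTwoVec_apply, f.injective.eq_iff]

theorem star_ellTwoShift_apply_eq_zero (f : ι ↪ ι) {j : ι} (h : ∀ i, f i ≠ j) :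
    star (ellTwoShift f) (ellTwoVec j) = 0 := by
  ext k
  rw [star_ellTwoShift_apply_apply, if_neg (h k)]
  rfl

theorem star_ellTwoShift_mul_self (f : ι ↪ ι) : star (ellTwoShift f) * ellTwoShift f = 1 :=
  ellTwo_clm_ext fun i => by
    rw [mul_apply_eq_comp, ellTwoShift_apply, star_ellTwoShift_apply]; rfl

theorem ellTwoShift_mul (f g : ι ↪ ι) : ellTwoShift f * ellTwoShift g = ellTwoShift (g.trans f) :=
  ellTwo_clm_ext fun i => by
    rw [mul_apply_eq_comp, ellTwoShift_apply, ellTwoShift_apply, ellTwoShift_apply]; rfl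

theorem ellTwoShift_mul_star_apply (f : ι ↪ ι) (i : ι) :
    (ellTwoShift f * star (ellTwoShift f)) (ellTwoVec (f i)) = ellTwoVec (f i) := by
  rw [mul_apply_eq_comp, star_ellTwoShift_apply, ellTwoShift_apply]

theorem ellTwoShift_mul_star_apply_eq_zero (f : ι ↪ ι) {j : ι} (h : ∀ i, f i ≠ j) :
    (ellTwoShift f * star (ellTwoShift f)) (ellTwoVec j) = 0 := by
  rw [mul_apply_eq_comp, star_ellTwoShift_apply_eq_zero f h, map_zero]

end EllTwo

/-! ### The regular representation on $\ell^2(M\times H)$. -/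

namespace CuntzLiPair

section regular

universe u v

variable {N : Type u} {H : Type v} [Group N] [Group H] (D : CuntzLiPair N H)

/-- Left multiplication by `a ∈ P` on `M × H ⊆ N ⋊ H`. -/
def regP (a : D.P) : D.M × H ↪ D.M × H where
  toFun w := (D.conj a w.1, a.1 * w.2)
  inj' := fun _ _ h => Prod.ext (D.conj_injective a (congrArg Prod.fst h))
    (mul_left_cancel (congrArg Prod.snd h))

/-- Left multiplication by `m ∈ M` on `M × H ⊆ N ⋊ H`. -/
def regM (m : D.M) : D.M × H ↪ D.M × H where
  toFun w := (m * w.1, w.2)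
  inj' := fun _ _ h => Prod.ext (mul_left_cancel (congrArg Prod.fst h))
    (Prod.ext_iff.1 h).2

theorem exists_regM (m : D.M) (w : D.M × H) : D.regM m (m⁻¹ * w.1, w.2) = w :=
  Prod.ext (mul_inv_cancel_left m w.1) rfl

/-- The Cuntz-Li family on `ℓ²(M × H)` given by the left multiplication in `N ⋊ H`. -/
noncomputable def regularFamily :
    D.CuntzLiFamily (lp (fun _ : D.M × H => ℂ) 2 →L[ℂ] lp (fun _ : D.M × H => ℂ) 2) where
  s a := ellTwoShift (D.regP a)
  u m := ellTwoShift (D.regM m)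
  star_s_mul_s a := star_ellTwoShift_mul_self _
  star_u_mul_u m := star_ellTwoShift_mul_self _
  u_mul_star_u m := ellTwo_clm_ext fun w => by
    rw [← D.exists_regM m w, ellTwoShift_mul_star_apply]; rfl
  s_mul_s a b := by
    rw [ellTwoShift_mul]
    congr 1
    ext1 w
    exact Prod.ext (D.conj_mul a b w.1).symm (mul_assoc _ _ _).symm
  u_mul_u m n := by
    rw [ellTwoShift_mul]
    congr 1
    ext1 w
    exact Prod.ext (mul_assoc _ _ _).symm rfl
  s_mul_u a m := by
    rw [ellTwoShift_mul, ellTwoShift_mul]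
    congr 1
    ext1 w
    exact Prod.ext (map_mul (D.conj a) m w.1) rfl
  sum_eq_one a := by
    classical
    have := Fintype.ofFinite (D.M ⧸ D.Mₐ a)
    rw [finsum_eq_sum_of_fintype]
    refine ellTwo_clm_ext fun w => ?_
    -- The summand at a coset of $M_a$ projects onto the vectors supported on pairs whose first
    -- coordinate lies in that coset. The second coordinate imposes no condition since $aH=H$. Hence
    -- only the coset of `w.1` contributes.
    rw [sum_apply, Finset.sum_eq_single (w.1 : D.M ⧸ D.Mₐ a)]
    · set n := (w.1 : D.M ⧸ D.Mₐ a).out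
      have hn : n⁻¹ * w.1 ∈ D.Mₐ a := by
        rw [← QuotientGroup.eq]; exact QuotientGroup.out_eq' _
      obtain ⟨k, hk⟩ := hn
      have hw : D.regP a (k, a.1⁻¹ * w.2) = (n⁻¹ * w.1, w.2) :=
        Prod.ext hk (mul_inv_cancel_left _ _)
      rw [← D.exists_regM n w, mul_apply_eq_comp, mul_apply_eq_comp,
        star_ellTwoShift_apply, ← hw, ellTwoShift_mul_star_apply, ellTwoShift_apply]
      rfl
    · intro q _ hq
      rw [mul_apply_eq_comp, mul_apply_eq_comp]
      conv_lhs => rw [← D.exists_regM q.out w]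
      rw [star_ellTwoShift_apply, ellTwoShift_mul_star_apply_eq_zero, map_zero]
      intro z hz
      apply hq
      rw [← QuotientGroup.out_eq' q, QuotientGroup.eq]
      exact ⟨z.1, congrArg Prod.fst hz⟩
    · intro h
      exact absurd (Finset.mem_univ _) h

/-- The regular realization of the Cuntz-Li relations. -/
noncomputable def regularRealization : Realization.{u, v} D where
  carrier := lp (fun _ : D.M × H => ℂ) 2 →L[ℂ] lp (fun _ : D.M × H => ℂ) 2
  nontrivial := ⟨1, 0, fun h => ellTwoVec_ne_zero ((1 : D.M), (1 : H)) (by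
    have := congrArg (fun T : lp (fun _ : D.M × H => ℂ) 2 →L[ℂ] lp (fun _ : D.M × H => ℂ) 2 =>
      T (ellTwoVec ((1 : D.M), (1 : H)))) h
    exact this)⟩
  family := D.regularFamily

/-- The regular realization is nonzero and the universal property gives a unital homomorphism to it.
Nonvanishing of the projections $u(m)e_au(m)^{-1}$ rests on this. -/
instance nontrivial_universalAlgebra : Nontrivial D.UniversalAlgebra := by
  obtain ⟨π, -⟩ := D.exists_starAlgHom D.regularRealization
  refine ⟨1, 0, fun h => ?_⟩
  have := congrArg π h
  rw [map_one, map_zero] at this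
  exact one_ne_zero this

/-- The pair $(m,h)$ is read as the element $mh$ of $G$. Such elements need not form a subgroup,
which is why the comparison with multiplication in $G$ is made separately for $a\in P$ and for $m\in
M$. -/
theorem inr_mul_regP (a : D.P) (w : D.M × H) :
    (⟨((D.regP a w).1 : N), (D.regP a w).2⟩ : D.G) =
      SemidirectProduct.inr a.1 * ⟨(w.1 : N), w.2⟩ := by
  ext
  · simp [← coe_conj]; rfl
  · simp; rfl

theorem inl_mul_regM (m : D.M) (w : D.M × H) :
    (⟨((D.regM m w).1 : N), (D.regM m w).2⟩ : D.G) =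
      SemidirectProduct.inl m.1 * ⟨(w.1 : N), w.2⟩ := by
  ext
  · simp; rfl
  · simp; rfl

/-- The operator is a partial translation: $s_b$ and $u(m)$ translate by $b$ and $m$, and $s_a^*$
undoes translation by $a$ where that is possible and vanishes elsewhere. Thus its matrix detects
$g=a^{-1}mb$. -/
theorem regularFamily_apply_ne_zero_iff (a b : D.P) (m : D.M) (w w' : D.M × H) :
    (star (D.regularFamily.s a) * D.regularFamily.u m * D.regularFamily.s b) (ellTwoVec w) w' ≠ 0 ↔
      (⟨(w'.1 : N), w'.2⟩ : D.G) = D.word a m b * ⟨(w.1 : N), w.2⟩ := by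
  rw [mul_apply_eq_comp, mul_apply_eq_comp]
  change (star (ellTwoShift (D.regP a)) (ellTwoShift (D.regM m)
    (ellTwoShift (D.regP b) (ellTwoVec w)))) w' ≠ 0 ↔ _
  rw [ellTwoShift_apply, ellTwoShift_apply, star_ellTwoShift_apply_apply_ne_zero_iff, word,
    mul_assoc, mul_assoc, ← inr_mul_regP, ← inl_mul_regM, eq_inv_mul_iff_mul_eq, ← inr_mul_regP]
  constructor
  · intro h; rw [h]
  · intro h
    have h₁ := congrArg SemidirectProduct.left h
    have h₂ := congrArg SemidirectProduct.right h
    exact Prod.ext (Subtype.ext h₁) h₂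

/-- The representation of the universal algebra on `ℓ²(M × H)`. -/
theorem exists_regular_starAlgHom : ∃ π : D.UniversalAlgebra →⋆ₐ[ℂ]
      (lp (fun _ : D.M × H => ℂ) 2 →L[ℂ] lp (fun _ : D.M × H => ℂ) 2),
    (∀ a, π (D.universalFamily.s a) = D.regularFamily.s a) ∧
      ∀ m, π (D.universalFamily.u m) = D.regularFamily.u m :=
  D.exists_starAlgHom D.regularRealization

/-- One has $(k,1)=k\cdot c\cdot(1,c^{-1})$, so the vector lies in the range of $u(k)s_c$. The
factor $c^{-1}$ need not be in $P$; this is the reason for using $H$ as the second coordinate. -/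
theorem regularFamily_proj_apply (k : D.M) (c : D.P) :
    D.regularFamily.proj k c (ellTwoVec (k, 1)) = ellTwoVec (k, 1) := by
  have h₁ : D.regM k (1, 1) = (k, 1) := Prod.ext (mul_one k) rfl
  have h₂ : D.regP c (1, c.1⁻¹) = (1, 1) := Prod.ext (map_one _) (mul_inv_cancel c.1)
  change (ellTwoShift (D.regM k) * (ellTwoShift (D.regP c) * star (ellTwoShift (D.regP c))) *
    star (ellTwoShift (D.regM k))) _ = _
  rw [mul_apply_eq_comp, mul_apply_eq_comp, ← h₁, star_ellTwoShift_apply,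
    ← h₂, ellTwoShift_mul_star_apply, ellTwoShift_apply]

theorem word_inv (a : D.P) (m : D.M) (b : D.P) : (D.word a m b)⁻¹ = D.word b m⁻¹ a := by
  simp only [word, mul_inv_rev, inv_inv, mul_assoc, InvMemClass.coe_inv, map_inv]

/-- An element `s_a* u(m) s_b` determines the group element `a⁻¹ m b`, even locally. -/
theorem word_eq_word_of_star_mul_proj_eq {a b a' b' c : D.P} {m m' k : D.M}
    (h : (D.universalFamily.elt a m b).1 * star (D.universalFamily.elt a m b).1 *
      D.universalFamily.proj k c = D.universalFamily.proj k c)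
    (h' : star (D.universalFamily.elt a m b).1 * D.universalFamily.proj k c =
      star (D.universalFamily.elt a' m' b').1 * D.universalFamily.proj k c) :
    D.word a m b = D.word a' m' b' := by
  classical
  obtain ⟨π, hs, hu⟩ := D.exists_regular_starAlgHom
  have ht : ∀ a m b, π (star (D.universalFamily.elt a m b).1) =
      star (D.regularFamily.s b) * D.regularFamily.u m⁻¹ * D.regularFamily.s a := by
    intro a m b
    rw [← CuntzLiFamily.star_u]
    simp only [CuntzLiFamily.elt, star_mul, star_star, map_mul, map_star, hs, hu, mul_assoc]
  have hp : π (D.universalFamily.proj k c) = D.regularFamily.proj k c := by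
    simp only [CuntzLiFamily.proj, map_mul, map_star, hs, hu]
  have e := congrArg (fun T => π T) h
  have e' := congrArg (fun T => π T) h'
  simp only [map_mul, hp, ht] at e e'
  have f := congrArg (fun T : lp (fun _ : D.M × H => ℂ) 2 →L[ℂ] lp (fun _ : D.M × H => ℂ) 2 =>
    T (ellTwoVec (k, 1))) e
  have f' := congrArg (fun T : lp (fun _ : D.M × H => ℂ) 2 →L[ℂ] lp (fun _ : D.M × H => ℂ) 2 =>
    T (ellTwoVec (k, 1))) e'
  simp only [mul_apply_eq_comp _ (D.regularFamily.proj k c), regularFamily_proj_apply] at f f'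
  rw [mul_apply_eq_comp] at f
  -- With $t=s_a^*u(m)s_b$ and $\delta$ the unit vector at $(k,1)$, `f` says $tt^*\delta=\delta$, so
  -- $t^*\delta$ has a nonzero coordinate. It sits at $g^{-1}(k,1)$, and by `f'` also at
  -- $g'^{-1}(k,1)$, which forces $g=g'$.
  obtain ⟨w', hw'⟩ : ∃ w', (star (D.regularFamily.s b) * D.regularFamily.u m⁻¹ *
      D.regularFamily.s a) (ellTwoVec (k, 1)) w' ≠ 0 := by
    by_contra! h₀
    have : (star (D.regularFamily.s b) * D.regularFamily.u m⁻¹ *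
      D.regularFamily.s a) (ellTwoVec (k, 1)) = 0 := by ext w'; exact h₀ w'
    rw [this, map_zero] at f
    exact ellTwoVec_ne_zero _ f.symm
  have hw'' := hw'
  rw [f'] at hw''
  rw [regularFamily_apply_ne_zero_iff] at hw' hw''
  rw [hw', ← word_inv, ← word_inv] at hw''
  exact inv_injective (mul_right_cancel hw'')

end regular

end CuntzLiPair

/-! ### Topological groupoids: reductions, transformation groupoids, transport along isomorphisms.
-/

section Groupoid

open ArrowGroupoid

theorem Reduction.continuous_arrow {Γ X : Type*} [ArrowGroupoid Γ X] [TopologicalSpace Γ]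
    {Y : Set X} : Continuous (arrow : Reduction Γ Y → Γ) :=
  continuous_induced_dom

theorem Reduction.continuous_iff {Γ X : Type*} [ArrowGroupoid Γ X] [TopologicalSpace Γ]
    {Y : Set X} {Z : Type*} [TopologicalSpace Z] {f : Z → Reduction Γ Y} :
    Continuous f ↔ Continuous fun z => (f z).arrow :=
  continuous_induced_rng

theorem IsTopologicalGroupoid.reduction {Γ X : Type*} [ArrowGroupoid Γ X] [TopologicalSpace Γ]
    [TopologicalSpace X] (h : IsTopologicalGroupoid Γ) (Y : Set X) :
    IsTopologicalGroupoid (Reduction Γ Y) where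
  continuous_rng := (h.continuous_rng.comp Reduction.continuous_arrow).subtype_mk _
  continuous_src := (h.continuous_src.comp Reduction.continuous_arrow).subtype_mk _
  continuous_one := Reduction.continuous_iff.2 (h.continuous_one.comp continuous_subtype_val)
  continuous_inv := Reduction.continuous_iff.2 (h.continuous_inv.comp Reduction.continuous_arrow)
  continuous_comp := Reduction.continuous_iff.2 <| h.continuous_comp.comp <|
    ((Reduction.continuous_arrow.comp (continuous_fst.comp continuous_subtype_val)).prodMk
      (Reduction.continuous_arrow.comp (continuous_snd.comp continuous_subtype_val))).subtype_mk
      fun p => congrArg Subtype.val p.2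

namespace TransformationGroupoid

variable {X G : Type*} [TopologicalSpace X]

theorem continuous_iff {Z : Type*} [TopologicalSpace Z] {f : Z → TransformationGroupoid X G} :
    Continuous f ↔ Continuous (fun z => (f z).pt) ∧ IsLocallyConstant fun z => (f z).elt := by
  let _ : TopologicalSpace G := ⊥
  have : DiscreteTopology G := ⟨rfl⟩
  rw [IsLocallyConstant.iff_continuous, continuous_induced_rng]
  exact continuous_prodMk

theorem continuous_pt : Continuous (pt : TransformationGroupoid X G → X) :=
  (continuous_iff.1 continuous_id).1

theorem isLocallyConstant_elt : IsLocallyConstant (elt : TransformationGroupoid X G → G) :=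
  (continuous_iff.1 continuous_id).2

/-- Since $G$ is discrete, the group element is constant near each arrow, so continuity of each
single $g$ on $X$ suffices. -/
theorem continuous_src' [Group G] [MulAction G X] [ContinuousConstSMul G X] :
    Continuous fun γ : TransformationGroupoid X G => γ.elt⁻¹ • γ.pt := by
  refine continuous_iff_continuousAt.2 fun γ => ?_
  refine ContinuousAt.congr (f := fun γ' : TransformationGroupoid X G => γ.elt⁻¹ • γ'.pt)
    (continuous_pt.continuousAt.const_smul _) ?_
  filter_upwards [isLocallyConstant_elt.eventually_eq γ] with γ' h
  rw [h]

theorem isTopologicalGroupoid [Group G] [MulAction G X] [ContinuousConstSMul G X] :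
    IsTopologicalGroupoid (TransformationGroupoid X G) where
  continuous_rng := continuous_pt
  continuous_src := continuous_src'
  continuous_one := continuous_iff.2 ⟨continuous_id, IsLocallyConstant.const 1⟩
  continuous_inv := continuous_iff.2 ⟨continuous_src', isLocallyConstant_elt.inv⟩
  continuous_comp := by
    have h₁ : Continuous fun p : {p : TransformationGroupoid X G × TransformationGroupoid X G //
        src p.1 = rng p.2} => p.1.1 := continuous_fst.comp continuous_subtype_val
    have h₂ : Continuous fun p : {p : TransformationGroupoid X G × TransformationGroupoid X G //
        src p.1 = rng p.2} => p.1.2 := continuous_snd.comp continuous_subtype_val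
    have h₃ := continuous_pt.comp h₁
    exact continuous_iff.2 ⟨h₃, (isLocallyConstant_elt.comp_continuous h₁).mul
      (isLocallyConstant_elt.comp_continuous h₂)⟩

end TransformationGroupoid

/-- A groupoid that is isomorphic to a topological groupoid is a topological groupoid. -/
theorem IsTopologicalGroupoidIso.isTopologicalGroupoid {Γ X Γ' X' : Type*} [ArrowGroupoid Γ X]
    [ArrowGroupoid Γ' X'] [TopologicalSpace Γ] [TopologicalSpace X] [TopologicalSpace Γ']
    [TopologicalSpace X'] {φ : Γ → Γ'} {φ₀ : X → X'} (hφ : IsTopologicalGroupoidIso φ φ₀)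
    (h : IsTopologicalGroupoid Γ) : IsTopologicalGroupoid Γ' := by
  let e := hφ.isHomeomorph.homeomorph
  let e₀ := hφ.isHomeomorph_units.homeomorph
  have he : ∀ g, φ (e.symm g) = g := e.apply_symm_apply
  have he₀ : ∀ x, φ₀ (e₀.symm x) = x := e₀.apply_symm_apply
  have hc := hφ.isHomeomorph.continuous
  have hc₀ := hφ.isHomeomorph_units.continuous
  have hr : (rng : Γ' → X') = φ₀ ∘ rng ∘ e.symm := by
    funext g
    rw [Function.comp_apply, Function.comp_apply, ← hφ.map_rng, he]
  have hs : (src : Γ' → X') = φ₀ ∘ src ∘ e.symm := by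
    funext g
    rw [Function.comp_apply, Function.comp_apply, ← hφ.map_src, he]
  refine ⟨?_, ?_, ?_, ?_, ?_⟩
  · rw [hr]
    exact hc₀.comp (h.continuous_rng.comp e.symm.continuous)
  · rw [hs]
    exact hc₀.comp (h.continuous_src.comp e.symm.continuous)
  · have : (one : X' → Γ') = φ ∘ one ∘ e₀.symm := by
      funext g
      rw [Function.comp_apply, Function.comp_apply, hφ.map_one, he₀]
    rw [this]
    exact hc.comp (h.continuous_one.comp e₀.symm.continuous)
  · have : (inv : Γ' → Γ') = φ ∘ inv ∘ e.symm := by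
      funext g
      rw [Function.comp_apply, Function.comp_apply, hφ.map_inv, he]
    rw [this]
    exact hc.comp (h.continuous_inv.comp e.symm.continuous)
  -- Injectivity on units is what pulls composability back along `φ`.
  · have hm : ∀ p : {p : Γ' × Γ' // src p.1 = rng p.2},
        src (e.symm p.1.1) = rng (e.symm p.1.2) := by
      intro p
      apply hφ.isHomeomorph_units.injective
      rw [← hφ.map_src, ← hφ.map_rng, he, he, p.2]
    have : (fun p : {p : Γ' × Γ' // src p.1 = rng p.2} => comp p.1.1 p.1.2 p.2) = fun p =>
        φ (comp (e.symm p.1.1) (e.symm p.1.2) (hm p)) := by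
      funext p
      rw [hφ.map_comp _ _ _ (by rw [he, he, p.2])]
      congr 1 <;> rw [he]
    rw [this]
    exact hc.comp (h.continuous_comp.comp
      (((e.symm.continuous.comp (continuous_fst.comp continuous_subtype_val)).prodMk
        (e.symm.continuous.comp (continuous_snd.comp continuous_subtype_val))).subtype_mk hm))

end Groupoid

namespace CuntzLiPair

variable {N H : Type*} [Group N] [Group H] (D : CuntzLiPair N H)

/-! ### Fractions $a^{-1}mb$ in $G$. -/

section words

theorem exists_word (g : D.G) : ∃ (a : D.P) (m : D.M) (b : D.P), g = D.word a m b := by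
  obtain ⟨a, c, m, hm, hc⟩ := Nbar.exists_smul_rep g 1
  refine ⟨a, m, c, ?_⟩
  rw [word, mul_assoc, eq_inv_mul_iff_mul_eq]
  rw [Submonoid.coe_one, mul_one] at hc
  ext
  · simpa using hm
  · simpa using hc

/-- Expansion of the fraction by $\alpha$. Together with `right_reversible` it gives two fractions
the same left denominator, where `word_injective` compares them. -/
theorem word_mul_left (α a : D.P) (m : D.M) (b : D.P) :
    D.word (α * a) (D.conj α m) (α * b) = D.word a m b := by
  have h : (SemidirectProduct.inl (D.conj α m).1 : D.G) =
      SemidirectProduct.inr α.1 * SemidirectProduct.inl m.1 * (SemidirectProduct.inr α.1)⁻¹ :=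
    (SemidirectProduct.inl_aut (φ := D.θ) α.1 m.1).trans (by rw [map_inv])
  rw [word, word, h]
  simp only [Submonoid.coe_mul, map_mul, mul_inv_rev, mul_assoc, inv_mul_cancel_left]

theorem word_injective {a : D.P} {m n : D.M} {b c : D.P} (h : D.word a m b = D.word a n c) :
    m = n ∧ b = c := by
  rw [word, word, mul_assoc, mul_assoc] at h
  have h := mul_left_cancel h
  have h₁ := congrArg SemidirectProduct.left h
  have h₂ := congrArg SemidirectProduct.right h
  exact ⟨Subtype.ext (by simpa using h₁), Subtype.ext (by simpa using h₂)⟩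

theorem word_one : D.word 1 1 1 = 1 := by simp [word]

theorem word_mul_word (a : D.P) (m : D.M) (b : D.P) (n : D.M) (c : D.P) :
    D.word a m b * D.word b n c = D.word a (m * n) c := by
  simp only [word, mul_assoc, mul_inv_cancel_left, Subgroup.coe_mul, map_mul]

/-- Two group elements whose product is formed can be written with a common denominator. -/
theorem exists_word₂ (g h : D.G) : ∃ (a : D.P) (m : D.M) (b : D.P) (n : D.M) (c : D.P),
    g = D.word a m b ∧ h = D.word b n c := by
  obtain ⟨a, m, b, rfl⟩ := D.exists_word g
  obtain ⟨c, n, d, rfl⟩ := D.exists_word h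
  obtain ⟨α, β, e⟩ := D.right_reversible b c
  refine ⟨α * a, D.conj α m, α * b, D.conj β n, β * d, (D.word_mul_left _ _ _ _).symm, ?_⟩
  rw [e, word_mul_left]

end words

/-! ### Conjugation by $P$ on $\overline M$ and the topology of $\overline M$. -/

section Mbar

/-- If $x_a$ is trivial, then each $x_{ac}$ is represented in $M_a$, say by $ak_ca^{-1}$.
Injectivity of conjugation by $a$ turns compatibility of the $x_{ac}$ modulo $M_{ac}$ into
compatibility of the $k_c$ modulo $M_c$. With `conjBar_apply_self` this describes $a\overline
Ma^{-1}$ as the open set $x_a=1$. -/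
theorem exists_conjBar_eq {a : D.P} {x : D.Mbar} (h : x.1 a = 1) : ∃ y, D.conjBar a y = x := by
  have hk : ∀ c : D.P, ∃ k : D.M, x.1 (a * c) = (D.conj a k : D.M) := by
    intro c
    obtain ⟨n, hn⟩ := D.exists_rep x (a * c)
    have hna := D.rep_mul hn
    rw [h, eq_comm, QuotientGroup.eq_one_iff] at hna
    obtain ⟨k, rfl⟩ := hna
    exact ⟨k, hn⟩
  choose k hk using hk
  refine ⟨⟨fun c => (k c : D.M ⧸ D.Mₐ c), fun c d => ?_⟩, ?_⟩
  · rw [QuotientGroup.map_mk, MonoidHom.id_apply]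
    have h₁ := hk (c * d)
    rw [← mul_assoc] at h₁
    have h₂ := (D.rep_mul h₁).symm.trans (hk c)
    rw [QuotientGroup.eq, ← map_inv, ← map_mul] at h₂
    rw [QuotientGroup.eq]
    obtain ⟨l, hl⟩ := h₂
    rw [conj_mul] at hl
    exact ⟨l, D.conj_injective a hl⟩
  · apply Subtype.ext
    funext b
    obtain ⟨α, β, hαβ⟩ := D.left_reversible a b
    rw [D.conjBar_apply hαβ _ rfl]
    have := hk α
    rw [hαβ] at this
    exact (D.rep_mul this).symm

theorem conjBar_apply_self (a : D.P) (x : D.Mbar) : (D.conjBar a x).1 a = 1 := by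
  obtain ⟨m, hm⟩ := D.exists_rep x 1
  rw [D.conjBar_apply (α := 1) (β := 1) rfl x hm]
  exact (QuotientGroup.eq_one_iff _).2 ⟨m, rfl⟩

theorem conjBar_apply_mul {a b : D.P} {x : D.Mbar} {m : D.M} (hm : x.1 b = m) :
    (D.conjBar a x).1 (a * b) = (D.conj a m : D.M) :=
  D.conjBar_apply (mul_one (a * b)).symm x hm

theorem conjBar_apply_mul_eq_iff (a b : D.P) (x y : D.Mbar) :
    (D.conjBar a x).1 (a * b) = (D.conjBar a y).1 (a * b) ↔ x.1 b = y.1 b := by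
  obtain ⟨m, hm⟩ := D.exists_rep x b
  obtain ⟨n, hn⟩ := D.exists_rep y b
  rw [D.conjBar_apply_mul hm, D.conjBar_apply_mul hn, hm, hn, QuotientGroup.eq, QuotientGroup.eq,
    ← map_inv, ← map_mul]
  constructor
  · rintro ⟨k, hk⟩
    rw [conj_mul] at hk
    exact ⟨k, D.conj_injective a hk⟩
  · rintro ⟨k, hk⟩
    exact ⟨k, by rw [conj_mul, hk]⟩

theorem apply_eq_of_apply_mul_eq {a b : D.P} {x y : D.Mbar} (h : x.1 (a * b) = y.1 (a * b)) :
    x.1 a = y.1 a := by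
  rw [← x.2 a b, h, y.2 a b]

/-- Directedness of $P$ under right multiples: a basic open set of the product, which restricts
finitely many components, contains one that is given by a single component. -/
theorem exists_common_multiple (I : Finset D.P) : ∃ c : D.P, ∀ a ∈ I, ∃ d, c = a * d := by
  classical
  induction I using Finset.induction_on with
  | empty => exact ⟨1, by simp⟩
  | insert b I _ ih =>
    obtain ⟨c, hc⟩ := ih
    obtain ⟨α, β, h⟩ := D.left_reversible b c
    refine ⟨b * α, fun a ha => ?_⟩
    rcases Finset.mem_insert.1 ha with rfl | ha
    · exact ⟨α, rfl⟩
    · obtain ⟨d, rfl⟩ := hc a ha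
      exact ⟨d * β, by rw [h, mul_assoc]⟩

instance (a : D.P) : DiscreteTopology (D.M ⧸ D.Mₐ a) := ⟨rfl⟩

instance : DiscreteTopology D.P := ⟨rfl⟩

theorem isOpen_setOf_apply_eq (a : D.P) (q : D.M ⧸ D.Mₐ a) : IsOpen {x : D.Mbar | x.1 a = q} :=
  (isOpen_discrete ({q} : Set (D.M ⧸ D.Mₐ a))).preimage
    ((continuous_apply a).comp continuous_subtype_val : Continuous fun x : D.Mbar => x.1 a)

/-- The sets `{y : y_a = x_a}` form a neighbourhood base at `x`. -/
theorem isOpen_Mbar_iff {U : Set D.Mbar} :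
    IsOpen U ↔ ∀ x ∈ U, ∃ a : D.P, ∀ y : D.Mbar, y.1 a = x.1 a → y ∈ U := by
  constructor
  · rintro ⟨V, hV, rfl⟩ x hx
    obtain ⟨I, u, hu, hIV⟩ := isOpen_pi_iff.1 hV x.1 hx
    obtain ⟨c, hc⟩ := D.exists_common_multiple I
    refine ⟨c, fun y hy => hIV fun a ha => ?_⟩
    obtain ⟨d, rfl⟩ := hc a ha
    rw [D.apply_eq_of_apply_mul_eq hy]
    exact (hu a ha).2
  · intro h
    rw [isOpen_iff_forall_mem_open]
    intro x hx
    obtain ⟨a, ha⟩ := h x hx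
    exact ⟨_, ha, D.isOpen_setOf_apply_eq a (x.1 a), rfl⟩

theorem continuous_conjBar (a : D.P) : Continuous (D.conjBar a) := by
  refine ⟨fun U hU => ?_⟩
  rw [isOpen_Mbar_iff] at hU ⊢
  intro x hx
  obtain ⟨b, hb⟩ := hU _ hx
  obtain ⟨α, β, h⟩ := D.left_reversible a b
  refine ⟨α, fun y hy => hb _ ?_⟩
  have := (D.conjBar_apply_mul_eq_iff a α y x).2 hy
  rw [h] at this
  exact D.apply_eq_of_apply_mul_eq this

/-- Agreement with $axa^{-1}$ at level $ab$ does two things: at level $a$ it forces a point into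
$a\overline Ma^{-1}$, and after cancelling $a$ it makes the preimage agree with $x$ at level $b$. -/
theorem isOpenMap_conjBar (a : D.P) : IsOpenMap (D.conjBar a) := by
  intro U hU
  rw [isOpen_Mbar_iff] at hU ⊢
  rintro _ ⟨x, hx, rfl⟩
  obtain ⟨b, hb⟩ := hU _ hx
  refine ⟨a * b, fun y hy => ?_⟩
  obtain ⟨z, rfl⟩ := D.exists_conjBar_eq ((D.apply_eq_of_apply_mul_eq hy).trans
    (D.conjBar_apply_self a x))
  exact ⟨z, hb z ((D.conjBar_apply_mul_eq_iff a b z x).1 hy), rfl⟩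

theorem continuous_mul_left_Mbar (x : D.Mbar) : Continuous fun y : D.Mbar => x * y := by
  refine ⟨fun U hU => ?_⟩
  rw [isOpen_Mbar_iff] at hU ⊢
  intro y hy
  obtain ⟨a, ha⟩ := hU _ hy
  exact ⟨a, fun z hz => ha _ (congrArg (x.1 a * ·) hz)⟩

end Mbar

/-! ### The space $\overline N$, its open subset $\overline M$, and the partial action of $G$ on it.
-/

section Nbar

/-- The class of $(y,b)$ plays the role of $b^{-1}yb$; a common left factor in the defining relation
cancels since conjugation is injective. -/
theorem Nbar.mk_eq_incl_iff (x y : D.Mbar) (b : D.P) :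
    Nbar.mk D y b = D.incl x ↔ y = D.conjBar b x := by
  constructor
  · intro h
    obtain ⟨α, β, h₁, h₂⟩ := Quotient.exact h
    change α * b = β * 1 at h₁
    change D.conjBar α y = D.conjBar β x at h₂
    rw [mul_one] at h₁
    rw [← h₁, ← conjBar_conjBar] at h₂
    exact D.conjBar_injective α h₂
  · rintro rfl
    exact Nbar.mk_eq 1 b (by simp) (D.conjBar_one _)

theorem incl_injective : Function.Injective D.incl := fun x y h => by
  have := (Nbar.mk_eq_incl_iff D y x 1).1 h
  rwa [conjBar_one] at this

theorem continuous_mk (a : D.P) : Continuous fun x => Nbar.mk D x a :=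
  continuous_quotient_mk'.comp (continuous_id.prodMk continuous_const)

theorem isOpen_Nbar_iff {U : Set D.Nbar} :
    IsOpen U ↔ ∀ a, IsOpen {x | Nbar.mk D x a ∈ U} := by
  refine ⟨fun h a => h.preimage (D.continuous_mk a), fun h => ?_⟩
  refine isOpen_coinduced.2 ?_
  have : (Quotient.mk D.nbarSetoid ⁻¹' U) = ⋃ a, {x | Nbar.mk D x a ∈ U} ×ˢ {a} := by
    ext ⟨x, a⟩
    simp only [Set.mem_iUnion, Set.mem_prod, Set.mem_ofPred_eq,
      Set.mem_singleton_iff, exists_eq_right']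
    rfl
  exact this ▸ isOpen_iUnion fun a => (h a).prod (isOpen_discrete _)

/-- The preimage of the image of $U$ in the sheet $\overline M\times\{b\}$ is $bUb^{-1}$, which is
open. -/
theorem isOpenEmbedding_incl : Topology.IsOpenEmbedding D.incl := by
  refine .of_continuous_injective_isOpenMap (D.continuous_mk 1) D.incl_injective fun U hU => ?_
  rw [isOpen_Nbar_iff]
  intro b
  convert D.isOpenMap_conjBar b U hU using 1
  ext y
  constructor
  · rintro ⟨x, hx, h⟩
    exact ⟨x, hx, ((Nbar.mk_eq_incl_iff D x y b).1 h.symm).symm⟩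
  · rintro ⟨x, hx, rfl⟩
    exact ⟨x, hx, ((Nbar.mk_eq_incl_iff D x _ b).2 rfl).symm⟩

instance : ContinuousConstSMul D.G D.Nbar where
  continuous_const_smul g := by
    refine ⟨fun U hU => ?_⟩
    rw [isOpen_Nbar_iff]
    intro b
    -- These choices depend on $g$ and $b$ only, so one formula describes the action of $g$ on the
    -- whole sheet over $b$.
    obtain ⟨a, c, m, hm, hc⟩ := Nbar.exists_smul_rep g b
    have : {x | Nbar.mk D x b ∈ (fun z => g • z) ⁻¹' U} =
        (fun x => Nbar.mk D (D.toMbar m * D.conjBar c x) a) ⁻¹' U := by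
      ext x
      simp only [Set.mem_ofPred_eq, Set.mem_preimage, Nbar.smul_mk g x b a c m hm hc]
    rw [this]
    exact hU.preimage ((D.continuous_mk a).comp
      ((D.continuous_mul_left_Mbar _).comp (D.continuous_conjBar c)))

theorem inr_smul_incl (a : D.P) (x : D.Mbar) :
    (SemidirectProduct.inr a.1 : D.G) • D.incl x = D.incl (D.conjBar a x) :=
  Nbar.inr_smul a 1 1 a (by simp) x

theorem inl_smul_incl (m : D.M) (x : D.Mbar) :
    (SemidirectProduct.inl m.1 : D.G) • D.incl x = D.incl (D.toMbar m * x) := by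
  rw [incl, Nbar.inl_smul, conj_one]; rfl

theorem word_inv_smul_incl_eq_iff (a : D.P) (m : D.M) (b : D.P) (x y : D.Mbar) :
    (D.word a m b)⁻¹ • D.incl x = D.incl y ↔ D.conjBar a x = D.toMbar m * D.conjBar b y := by
  rw [inv_smul_eq_iff, word, mul_assoc, mul_smul, eq_inv_smul_iff, mul_smul, inr_smul_incl,
    inr_smul_incl, inl_smul_incl, D.incl_injective.eq_iff]

/-- The equation $axa^{-1}=m\,byb^{-1}$ is solvable for $y\in\overline M$ exactly when
$m^{-1}axa^{-1}$ lies in $b\overline Mb^{-1}$, that is, when its component at $b$ is trivial. -/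
theorem word_inv_smul_incl_mem_range_iff (a : D.P) (m : D.M) (b : D.P) (x : D.Mbar) :
    (D.word a m b)⁻¹ • D.incl x ∈ Set.range D.incl ↔ (D.conjBar a x).1 b = m := by
  constructor
  · rintro ⟨y, hy⟩
    rw [(D.word_inv_smul_incl_eq_iff a m b x y).1 hy.symm]
    change (m : D.M ⧸ D.Mₐ b) * (D.conjBar b y).1 b = m
    rw [conjBar_apply_self, mul_one]
  · intro h
    have h' : ((D.toMbar m)⁻¹ * D.conjBar a x).1 b = 1 := by
      change (m : D.M ⧸ D.Mₐ b)⁻¹ * (D.conjBar a x).1 b = 1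
      rw [h, inv_mul_cancel]
    obtain ⟨y, hy⟩ := D.exists_conjBar_eq h'
    exact ⟨y, ((D.word_inv_smul_incl_eq_iff a m b x y).2 (by rw [hy, mul_inv_cancel_left])).symm⟩

end Nbar

namespace CuntzLiFamily

variable {D} {A : Type*} [CStarAlgebra A] (v : D.CuntzLiFamily A)

/-! ### Projections at a fixed level and the structure of $F$. -/

section projections

theorem s_mul_proj (a : D.P) (m : D.M) (b : D.P) :
    v.s a * v.proj m b = v.proj (D.conj a m) (a * b) * v.s a := by
  rw [← s_conj, mul_assoc _ (star _), star_s_mul_s, mul_one]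

theorem star_s_mul_proj_mul_s (a : D.P) (m : D.M) (b : D.P) :
    star (v.s a) * v.proj (D.conj a m) (a * b) * v.s a = v.proj m b := by
  rw [mul_assoc, ← s_mul_proj, ← mul_assoc, star_s_mul_s, one_mul]

theorem proj_one : v.proj 1 1 = 1 := by simp [proj, u_one, s_one]

theorem proj_one_left (a : D.P) : v.proj 1 a = v.s a * star (v.s a) := by simp [proj, u_one]

/-- Since $s_{bc}=s_bs_c$, the range of $u(n)s_{bc}$ lies in that of $u(n)s_b$: the level $bc$
refines the level $b$. -/
theorem proj_mul_proj {b c : D.P} {m n : D.M} (h : (m : D.M ⧸ D.Mₐ b) = n) :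
    v.proj m b * v.proj n (b * c) = v.proj n (b * c) := by
  rw [v.proj_eq h]
  calc v.proj n b * v.proj n (b * c)
      = v.u n * v.s b * star (v.s b) * (star (v.u n) * v.u n) * v.s (b * c) * star (v.s (b * c)) *
          star (v.u n) := by simp only [proj, mul_assoc]
    _ = v.u n * v.s b * (star (v.s b) * v.s b) * v.s c * star (v.s (b * c)) * star (v.u n) := by
        rw [star_u_mul_u, mul_one, ← v.s_mul_s b c]; simp only [mul_assoc]
    _ = v.proj n (b * c) := by
        rw [star_s_mul_s, mul_one, mul_assoc _ (v.s b), v.s_mul_s]; simp only [proj, mul_assoc]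

theorem proj_ne_zero [Nontrivial A] (m : D.M) (a : D.P) : v.proj m a ≠ 0 := by
  intro h
  have : star (v.s a) * (star (v.u m) * v.proj m a * v.u m) * v.s a = 1 := by
    calc _ = star (v.s a) * (star (v.u m) * v.u m) * v.s a *
          (star (v.s a) * (star (v.u m) * v.u m) * v.s a) := by simp only [proj, mul_assoc]
      _ = 1 := by rw [star_u_mul_u, mul_one, star_s_mul_s, mul_one]
  rw [h] at this
  simp at this

/-- `v.Xₐ a` is spanned by projections that are equal or orthogonal, so each of them is an
eigenvector for multiplication by this algebra. -/
theorem exists_mul_proj_eq_smul {a : D.P} {x : A} (hx : x ∈ v.Xₐ a) (m : D.M) :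
    ∃ c : ℂ, x * v.proj m a = c • v.proj m a := by
  induction hx using Submodule.span_induction with
  | mem x h =>
    obtain ⟨n, rfl⟩ := h
    by_cases hmn : (n : D.M ⧸ D.Mₐ a) = m
    · exact ⟨1, by
        change v.proj n a * _ = _
        rw [v.proj_eq hmn, (v.proj_isStarProjection m a).isIdempotentElem.eq, one_smul]⟩
    · exact ⟨0, by rw [zero_smul]; exact v.proj_mul_of_ne hmn⟩
  | zero => exact ⟨0, by simp⟩
  | add x y _ _ hx hy =>
    obtain ⟨c, hc⟩ := hx
    obtain ⟨d, hd⟩ := hy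
    exact ⟨c + d, by rw [add_mul, hc, hd, add_smul]⟩
  | smul k x _ hx =>
    obtain ⟨c, hc⟩ := hx
    exact ⟨k * c, by rw [smul_mul_assoc, hc, mul_smul]⟩

/-- Every projection in `F` is a sum of some of the projections `u(m) e_a u(m)⁻¹`, for a suitable
`a`. -/
theorem exists_mul_proj_eq_zero_or {f : A} (hf : f ∈ v.F) :
    ∃ a, ∀ m, f * v.proj m a = 0 ∨ f * v.proj m a = v.proj m a := by
  obtain ⟨a, ha⟩ := v.exists_mem_Xₐ hf.2
  refine ⟨a, fun m => ?_⟩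
  obtain ⟨c, hc⟩ := v.exists_mul_proj_eq_smul ha m
  -- Idempotence of $f$ forces $c^2=c$, unless the projection itself is zero; a zero algebra is not
  -- yet excluded here.
  have h : (c * c - c) • v.proj m a = 0 := by
    rw [sub_smul, mul_smul, ← hc, ← mul_smul_comm, ← hc, ← mul_assoc,
      hf.1.isIdempotentElem.eq, sub_self]
  rcases smul_eq_zero.1 h with h | h
  · rcases mul_eq_zero.1 (show c * (c - 1) = 0 by rw [mul_sub, mul_one, h]) with h | h
    · exact .inl (by rw [hc, h, zero_smul])
    · exact .inr (by rw [hc, sub_eq_zero.1 h, one_smul])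
  · exact .inl (by rw [h, mul_zero])

end projections

/-! ### The support of the character of a point of $\overline M$, and its behaviour under
conjugation. -/

section support

/-- `f ≥ u(r_a) e_a u(r_a)⁻¹` for some `a ∈ P`. -/
def Dominates (r : D.Mbar) (f : A) : Prop :=
  ∃ (a : D.P) (m : D.M), r.1 a = m ∧ f * v.proj m a = v.proj m a

variable {v}

/-- The projections selected by $r$ decrease as the level is refined. This allows conditions
witnessed at different levels to be compared at a common right multiple. -/
theorem mul_proj_eq_of_mul_proj_eq {r : D.Mbar} {f : A} {a b : D.P} {m n : D.M}
    (hm : r.1 a = m) (hf : f * v.proj m a = v.proj m a) (hn : r.1 (a * b) = n) :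
    f * v.proj n (a * b) = v.proj n (a * b) := by
  have h : (m : D.M ⧸ D.Mₐ a) = n := by rw [← hm, D.rep_mul hn]
  rw [← v.proj_mul_proj h, ← mul_assoc, hf]

theorem dominates_one (r : D.Mbar) : v.Dominates r 1 := by
  obtain ⟨m, hm⟩ := D.exists_rep r 1
  exact ⟨1, m, hm, one_mul _⟩

theorem not_dominates_zero [Nontrivial A] (r : D.Mbar) : ¬ v.Dominates r 0 := by
  rintro ⟨a, m, -, h⟩
  rw [zero_mul] at h
  exact v.proj_ne_zero m a h.symm

theorem dominates_mul {r : D.Mbar} {f g : A} (hf : f ∈ v.F) (hg : g ∈ v.F) :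
    v.Dominates r (f * g) ↔ v.Dominates r f ∧ v.Dominates r g := by
  constructor
  · rintro ⟨a, m, hm, h⟩
    refine ⟨⟨a, m, hm, ?_⟩, ⟨a, m, hm, ?_⟩⟩
    · rw [← h, ← mul_assoc, ← mul_assoc, hf.1.isIdempotentElem.eq]
    · rw [(v.mul_mem_X hf.2 hg.2).2] at h
      rw [← h, ← mul_assoc, ← mul_assoc, hg.1.isIdempotentElem.eq]
  · rintro ⟨⟨a, m, hm, h⟩, ⟨b, n, hn, h'⟩⟩
    obtain ⟨α, β, e⟩ := D.left_reversible a b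
    obtain ⟨k, hk⟩ := D.exists_rep r (a * α)
    refine ⟨a * α, k, hk, ?_⟩
    rw [mul_assoc]
    have := mul_proj_eq_of_mul_proj_eq hn h' (e ▸ hk)
    rw [← e] at this
    rw [this, mul_proj_eq_of_mul_proj_eq hm h hk]

/-- At a level refining both $a$ and $b$, the projection selected by $r$ lies under
$u(r_b)e_bu(r_b)^{-1}$. If $m\not\equiv r_b$, orthogonality at level $b$ would make this nonzero
projection vanish. -/
theorem dominates_proj_iff [Nontrivial A] {r : D.Mbar} {m : D.M} {b : D.P} :
    v.Dominates r (v.proj m b) ↔ r.1 b = m := by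
  constructor
  · rintro ⟨a, n, hn, h⟩
    obtain ⟨α, β, e⟩ := D.left_reversible a b
    obtain ⟨k, hk⟩ := D.exists_rep r (a * α)
    have h₁ := mul_proj_eq_of_mul_proj_eq hn h hk
    rw [e] at hk h₁
    rw [D.rep_mul hk]
    by_contra h₂
    rw [← v.proj_mul_proj (c := β) (rfl : (k : D.M ⧸ D.Mₐ b) = k), ← mul_assoc,
      v.proj_mul_of_ne (Ne.symm h₂), zero_mul] at h₁
    rw [v.proj_mul_proj rfl] at h₁
    exact v.proj_ne_zero _ _ h₁.symm
  · intro h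
    exact ⟨b, m, h, (v.proj_isStarProjection m b).isIdempotentElem⟩

theorem dominates_toMbar_mul_iff {r : D.Mbar} {m : D.M} {f : A} :
    v.Dominates (D.toMbar m * r) (v.u m * f * star (v.u m)) ↔ v.Dominates r f := by
  have key : ∀ (m : D.M) (r : D.Mbar) (f : A), v.Dominates r f →
      v.Dominates (D.toMbar m * r) (v.u m * f * star (v.u m)) := by
    rintro m r f ⟨a, n, hn, h⟩
    refine ⟨a, m * n, congrArg ((m : D.M ⧸ D.Mₐ a) * ·) hn, ?_⟩
    rw [← u_conj]
    calc v.u m * f * star (v.u m) * (v.u m * v.proj n a * star (v.u m))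
        = v.u m * f * (star (v.u m) * v.u m) * v.proj n a * star (v.u m) := by
          simp only [mul_assoc]
      _ = _ := by rw [star_u_mul_u, mul_one, mul_assoc _ f, h]
  refine ⟨fun h => ?_, key m r f⟩
  have h' := key m⁻¹ _ _ h
  rw [← star_u, star_star, map_inv, inv_mul_cancel_left] at h'
  rwa [← mul_assoc, ← mul_assoc, star_u_mul_u, one_mul, mul_assoc, star_u_mul_u, mul_one] at h'

/-- Conjugation by $s_a$ carries the projection that $r$ selects at level $\alpha$ to the one that
$ara^{-1}$ selects at level $a\alpha$, and levels of the form $a\alpha$ are cofinal. Commutativity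
of `v.X` lets $f$ pass $e_a$. -/
theorem dominates_conjBar_iff {r : D.Mbar} {a : D.P} {f : A} (hf : f ∈ v.X) :
    v.Dominates (D.conjBar a r) f ↔ v.Dominates r (star (v.s a) * f * v.s a) := by
  constructor
  · rintro ⟨b, n, hn, h⟩
    obtain ⟨α, β, e⟩ := D.left_reversible a b
    obtain ⟨k, hk⟩ := D.exists_rep r α
    have hk' : (D.conjBar a r).1 (b * β) = (D.conj a k : D.M) := by
      have := D.conjBar_apply_mul (a := a) hk
      rwa [e] at this
    have h' := mul_proj_eq_of_mul_proj_eq hn h hk'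
    rw [← e] at h'
    refine ⟨α, k, hk, ?_⟩
    rw [mul_assoc, s_mul_proj, mul_assoc, ← mul_assoc f, h', ← mul_assoc, star_s_mul_proj_mul_s]
  · rintro ⟨α, k, hk, h⟩
    refine ⟨a * α, D.conj a k, D.conjBar_apply_mul hk, ?_⟩
    have hc : v.s a * star (v.s a) * f = f * (v.s a * star (v.s a)) := by
      rw [← proj_one_left]
      exact (v.mul_mem_X (v.proj_mem_X 1 a) hf).2
    rw [← s_conj]
    calc f * (v.s a * v.proj k α * star (v.s a))
        = f * (v.s a * (star (v.s a) * v.s a) * v.proj k α * star (v.s a)) := by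
          rw [star_s_mul_s, mul_one]
      _ = (f * (v.s a * star (v.s a))) * v.s a * v.proj k α * star (v.s a) := by
          simp only [mul_assoc]
      _ = v.s a * (star (v.s a) * f * v.s a * v.proj k α) * star (v.s a) := by
          rw [← hc]; simp only [mul_assoc]
      _ = _ := by rw [h]

/-- At a level where $f$ is a sum of the basic projections, membership of $f$ in the support is
decided by $r_a$ alone. This yields both continuity in $r$ and the maximality of the characters. -/
theorem exists_dominates_iff [Nontrivial A] {f : A} (hf : f ∈ v.F) :
    ∃ a, ∀ (r : D.Mbar) (m : D.M), r.1 a = m →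
      (v.Dominates r f ∧ f * v.proj m a = v.proj m a) ∨
        (¬ v.Dominates r f ∧ f * v.proj m a = 0) := by
  obtain ⟨a, ha⟩ := v.exists_mul_proj_eq_zero_or hf
  refine ⟨a, fun r m hm => ?_⟩
  rcases ha m with h | h
  · refine .inr ⟨fun h' => not_dominates_zero (v := v) r ?_, h⟩
    rw [← h, dominates_mul hf (v.proj_mem_F m a)]
    exact ⟨h', dominates_proj_iff.2 hm⟩
  · exact .inl ⟨⟨a, m, hm, h⟩, h⟩

end support

/-! ### The partial representation $g\mapsto t_g$ of $G$ in $T$. -/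

section elements

theorem elt_val (a : D.P) (m : D.M) (b : D.P) :
    (v.elt a m b).1 = star (v.s a) * v.u m * v.s b := rfl

theorem coe_mul (t t' : v.T) : (t * t').1 = t.1 * t'.1 := rfl

theorem coe_star (t : v.T) : (star t).1 = star t.1 := rfl

theorem elt_mul_left (α a : D.P) (m : D.M) (b : D.P) :
    v.elt (α * a) (D.conj α m) (α * b) = v.elt a m b := by
  apply Subtype.ext
  rw [elt_val, elt_val, ← star_s_mul_star_s, mul_assoc (star (v.s a)), ← u_mul_star_s,
    ← v.s_mul_s]
  calc _ = star (v.s a) * v.u m * (star (v.s α) * v.s α) * v.s b := by simp only [mul_assoc]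
    _ = _ := by rw [star_s_mul_s, mul_one]

theorem elt_eq_of_word_eq {a b c d : D.P} {m n : D.M} (h : D.word a m b = D.word c n d) :
    v.elt a m b = v.elt c n d := by
  obtain ⟨α, β, e⟩ := D.right_reversible a c
  rw [← D.word_mul_left α, ← D.word_mul_left β c, e] at h
  obtain ⟨h₁, h₂⟩ := D.word_injective h
  rw [← v.elt_mul_left α, ← v.elt_mul_left β c, e, h₁, h₂]

/-- The element `s_a* u(m) s_b` of `T` for `g = a⁻¹ m b`. -/
noncomputable def ofGroup (g : D.G) : v.T :=
  v.elt (D.exists_word g).choose (D.exists_word g).choose_spec.choose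
    (D.exists_word g).choose_spec.choose_spec.choose

theorem ofGroup_word (a : D.P) (m : D.M) (b : D.P) : v.ofGroup (D.word a m b) = v.elt a m b :=
  v.elt_eq_of_word_eq (D.exists_word (D.word a m b)).choose_spec.choose_spec.choose_spec.symm

theorem coe_ofGroup_one : (v.ofGroup 1).1 = 1 := by
  rw [← D.word_one, ofGroup_word, elt_val, u_one, s_one]; simp

theorem ofGroup_inv (g : D.G) : v.ofGroup g⁻¹ = star (v.ofGroup g) := by
  obtain ⟨a, m, b, rfl⟩ := D.exists_word g
  apply Subtype.ext
  rw [D.word_inv, ofGroup_word, ofGroup_word, coe_star, elt_val, elt_val, star_mul, star_mul,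
    star_star, star_u, mul_assoc]

/-- Write $g=a^{-1}mb$ and $h=b^{-1}nc$. Then $t_gt_h=s_a^*\,u(m)e_bu(m)^{-1}\,u(mn)s_c$, while
$t_gt_g^*=s_a^*\,u(m)e_bu(m)^{-1}\,s_a$. The factor $e_a$ arising between the latter and $t_{gh}$
commutes to the left and is absorbed by $s_a^*$. -/
theorem ofGroup_mul (g h : D.G) :
    v.ofGroup g * star (v.ofGroup g) * v.ofGroup (g * h) = v.ofGroup g * v.ofGroup h := by
  obtain ⟨a, m, b, n, c, rfl, rfl⟩ := D.exists_word₂ g h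
  rw [D.word_mul_word, ofGroup_word, ofGroup_word, ofGroup_word]
  apply Subtype.ext
  simp only [coe_mul, coe_star, elt_val]
  have hc := (v.mul_mem_X (v.proj_mem_X m b) (v.proj_mem_X 1 a)).2
  rw [proj_one_left] at hc
  calc _ = star (v.s a) * (v.proj m b * (v.s a * star (v.s a))) * v.u (m * n) * v.s c := by
        simp only [proj, star_mul, star_star, mul_assoc]
    _ = (star (v.s a) * v.s a) * star (v.s a) * v.u m * v.s b * star (v.s b) *
          (star (v.u m) * v.u m) * v.u n * v.s c := by
        rw [hc, ← v.u_mul_u]; simp only [proj, mul_assoc]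
    _ = _ := by rw [star_s_mul_s, star_u_mul_u, one_mul, mul_one]; simp only [mul_assoc]

/-- The relation between the points reads $ara^{-1}=m\,br'b^{-1}$. Conjugation of $f$ by $t_g$ is
conjugation by $s_b$, $u(m)$ and $s_a^*$ in turn, and the support transforms accordingly at each
stage. -/
theorem dominates_conj_ofGroup_iff {g : D.G} {r r' : D.Mbar} (h : g⁻¹ • D.incl r = D.incl r')
    {f : A} (hf : f ∈ v.X) :
    v.Dominates r ((v.ofGroup g).1 * f * star (v.ofGroup g).1) ↔ v.Dominates r' f := by
  obtain ⟨a, m, b, rfl⟩ := D.exists_word g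
  rw [D.word_inv_smul_incl_eq_iff] at h
  have e : (v.ofGroup (D.word a m b)).1 * f * star (v.ofGroup (D.word a m b)).1 =
      star (v.s a) * (v.u m * (v.s b * f * star (v.s b)) * star (v.u m)) * v.s a := by
    rw [ofGroup_word, elt_val]; simp only [star_mul, star_star, mul_assoc]
  have e' : star (v.s b) * (v.s b * f * star (v.s b)) * v.s b = f := by
    calc _ = (star (v.s b) * v.s b) * f * (star (v.s b) * v.s b) := by simp only [mul_assoc]
      _ = f := by rw [star_s_mul_s, one_mul, mul_one]
  rw [e, ← dominates_conjBar_iff (v.u_conj_mem_X m (v.s_conj_mem_X b hf)), h,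
    dominates_toMbar_mul_iff, dominates_conjBar_iff (v.s_conj_mem_X b hf), e']

theorem exists_inv_smul_incl_of_dominates [Nontrivial A] {g : D.G} {r : D.Mbar}
    (h : v.Dominates r ((v.ofGroup g).1 * star (v.ofGroup g).1)) :
    g⁻¹ • D.incl r ∈ Set.range D.incl := by
  obtain ⟨a, m, b, rfl⟩ := D.exists_word g
  have e : (v.ofGroup (D.word a m b)).1 * star (v.ofGroup (D.word a m b)).1 =
      star (v.s a) * v.proj m b * v.s a := by
    rw [ofGroup_word, elt_val]; simp only [proj, star_mul, star_star, mul_assoc]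
  rwa [e, ← dominates_conjBar_iff (v.proj_mem_X m b), dominates_proj_iff,
    ← D.word_inv_smul_incl_mem_range_iff] at h

/-- Every element of `T` is a restriction of one of the elements `s_a* u(m) s_b`. -/
theorem exists_eq_mul_ofGroup (t : v.T) :
    ∃ (g : D.G) (f : A), f ∈ v.F ∧ t.1 = f * (v.ofGroup g).1 := by
  obtain ⟨a, f, m, b, hf, ht⟩ := v.mem_T_iff.1 t.2
  refine ⟨D.word a m b, star (v.s a) * f * v.s a, v.star_s_conj_mem_F a hf, ?_⟩
  have hc := (v.mul_mem_X hf.2 (v.proj_mem_X 1 a)).2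
  rw [proj_one_left] at hc
  rw [ht, ofGroup_word, elt_val]
  symm
  calc _ = star (v.s a) * (f * (v.s a * star (v.s a))) * v.u m * v.s b := by simp only [mul_assoc]
    _ = (star (v.s a) * v.s a) * star (v.s a) * f * v.u m * v.s b := by
        rw [hc]; simp only [mul_assoc]
    _ = _ := by rw [star_s_mul_s, one_mul]

end elements

end CuntzLiFamily

end CuntzLiPair

/-! ### Ultrafilters of projections in an inverse semigroup. -/

namespace InverseSemigroupWithZero

variable {S : Type*} [InverseSemigroupWithZero S]

namespace Proj

instance : CommSemigroup (Proj S) where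
  mul_assoc e f g := Proj.ext (mul_assoc e.1 f.1 g.1)
  mul_comm e f := Proj.ext (proj_comm e.2 f.2)

theorem mul_self (e : Proj S) : e * e = e := Proj.ext e.2.isIdempotentElem

theorem zero_mul (e : Proj S) : 0 * e = 0 := Proj.ext (MulZeroClass.zero_mul e.1)

theorem mul_zero (e : Proj S) : e * 0 = 0 := Proj.ext (MulZeroClass.mul_zero e.1)

end Proj

namespace Character

theorem continuous_apply (e : Proj S) : Continuous fun x : Character S => x.1 e :=
  (_root_.continuous_apply e).comp continuous_induced_dom

theorem isOpen_setOf_apply (e : Proj S) : IsOpen {x : Character S | x.1 e = true} :=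
  (isOpen_discrete ({true} : Set Bool)).preimage (continuous_apply e)

theorem isClosed_setOf_apply (e : Proj S) : IsClosed {x : Character S | x.1 e = true} :=
  (isClosed_discrete ({true} : Set Bool)).preimage (continuous_apply e)

/-- The support of a maximal character contains each projection that meets all its elements. -/
theorem apply_eq_true_of_mem_maximal {x : Character S} (hx : x ∈ maximal S) {e : Proj S}
    (h : ∀ f, x.1 f = true → f * e ≠ 0) : x.1 e = true := by
  classical
  -- The filter generated by $e$ and the support of $x$. It omits $0$ by hypothesis, so maximality
  -- identifies it with the support of $x$.
  let y : Character S :=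
    { val := fun f => decide (∃ g, x.1 g = true ∧ g * e * f = g * e)
      map_mul' := by
        intro f₁ f₂
        rw [← Bool.decide_and, decide_eq_decide]
        constructor
        · rintro ⟨g, hg, h⟩
          refine ⟨⟨g, hg, ?_⟩, ⟨g, hg, ?_⟩⟩
          · calc g * e * f₁ = g * e * (f₁ * f₂) * f₁ := by rw [h]
              _ = g * e * (f₁ * f₁ * f₂) := by ac_rfl
              _ = g * e := by rw [Proj.mul_self, h]
          · calc g * e * f₂ = g * e * (f₁ * f₂) * f₂ := by rw [h]
              _ = g * e * (f₁ * (f₂ * f₂)) := by ac_rfl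
              _ = g * e := by rw [Proj.mul_self, h]
        · rintro ⟨⟨g₁, hg₁, h₁⟩, ⟨g₂, hg₂, h₂⟩⟩
          refine ⟨g₁ * g₂, by rw [x.map_mul', hg₁, hg₂]; rfl, ?_⟩
          calc g₁ * g₂ * e * (f₁ * f₂) = g₁ * g₂ * (e * e) * (f₁ * f₂) := by rw [Proj.mul_self]
            _ = (g₁ * e * f₁) * (g₂ * e * f₂) := by ac_rfl
            _ = g₁ * g₂ * (e * e) := by rw [h₁, h₂]; ac_rfl
            _ = _ := by rw [Proj.mul_self]
      map_zero' := by
        rw [decide_eq_false_iff_not]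
        rintro ⟨g, hg, h₀⟩
        rw [Proj.mul_zero] at h₀
        exact h g hg h₀.symm
      exists_eq_true := by
        obtain ⟨g, hg⟩ := x.exists_eq_true
        exact ⟨e, decide_eq_true ⟨g, hg, by rw [mul_assoc, Proj.mul_self]⟩⟩ }
  have hy : y = x := hx y fun f hf => decide_eq_true ⟨f, hf, by
    rw [mul_right_comm, Proj.mul_self]⟩
  obtain ⟨g, hg⟩ := x.exists_eq_true
  rw [← hy]
  exact decide_eq_true ⟨g, hg, by rw [mul_assoc, Proj.mul_self]⟩

end Character

end InverseSemigroupWithZero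

/-! ### Tight characters of $F$ are the points of $\overline M$. -/

namespace CuntzLiPair

variable {N H : Type*} [Group N] [Group H] {D : CuntzLiPair N H}

namespace CuntzLiFamily

open InverseSemigroupWithZero

variable {A : Type*} [CStarAlgebra A] (v : D.CuntzLiFamily A)

theorem coe_mem_F (e : Proj v.T) : e.val.1 ∈ v.F := by
  have h := v.mul_star_mem_F e.val.2
  have h₁ : star e.val.1 = e.val.1 := congrArg Subtype.val e.2.isSelfAdjoint.star_eq
  have h₂ : e.val.1 * e.val.1 = e.val.1 := congrArg Subtype.val e.2.isIdempotentElem.eq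
  rwa [h₁, h₂] at h

/-- An element of `F` as a projection of the inverse semigroup `T`. -/
noncomputable def toProj (f : A) (hf : f ∈ v.F) : Proj v.T where
  val := ⟨f, 1, 1, f, 1, 1, hf, by simp [u_one, s_one]⟩
  isStarProjection := ⟨Subtype.ext hf.1.isIdempotentElem, Subtype.ext hf.1.isSelfAdjoint⟩

/-- The projection `u(m) e_a u(m)⁻¹` of the inverse semigroup `T`. -/
noncomputable abbrev projT (m : D.M) (a : D.P) : Proj v.T := v.toProj _ (v.proj_mem_F m a)

theorem projT_eq {m n : D.M} {a : D.P} (h : (m : D.M ⧸ D.Mₐ a) = n) : v.projT m a = v.projT n a :=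
  Proj.ext (Subtype.ext (v.proj_eq h))

/-- If no coset were selected, maximality would give for each coset an element of the support
orthogonal to its projection. The product of these finitely many elements is orthogonal to all
summands of $1$, hence is $0$, yet lies in the support. -/
theorem exists_projT_of_mem_maximal {χ : Character v.T} (hχ : χ ∈ Character.maximal v.T)
    (a : D.P) : ∃ m, χ.1 (v.projT m a) = true := by
  classical
  have := Fintype.ofFinite (D.M ⧸ D.Mₐ a)
  by_contra! h
  have h₁ : ∀ m, ∃ f, χ.1 f = true ∧ f * v.projT m a = 0 := by
    intro m
    by_contra! h'
    exact h m (Character.apply_eq_true_of_mem_maximal hχ h')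
  have h₂ : ∀ I : Finset (D.M ⧸ D.Mₐ a), ∃ f, χ.1 f = true ∧
      ∀ q ∈ I, f * v.projT q.out a = 0 := by
    intro I
    induction I using Finset.induction_on with
    | empty =>
      obtain ⟨f, hf⟩ := χ.exists_eq_true
      exact ⟨f, hf, by simp⟩
    | insert q I _ ih =>
      obtain ⟨f, hf, hfI⟩ := ih
      obtain ⟨g, hg, hgq⟩ := h₁ q.out
      refine ⟨f * g, by rw [χ.map_mul', hf, hg]; rfl, fun p hp => ?_⟩
      rcases Finset.mem_insert.1 hp with rfl | hp
      · rw [mul_assoc, hgq, Proj.mul_zero]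
      · rw [mul_right_comm, hfI p hp, Proj.zero_mul]
  obtain ⟨f, hf, h₃⟩ := h₂ Finset.univ
  have h₄ : f = 0 := by
    apply Proj.ext
    apply Subtype.ext
    change f.val.1 = 0
    rw [← mul_one f.val.1, ← v.sum_proj a, Finset.mul_sum]
    exact Finset.sum_eq_zero fun q hq =>
      congrArg (fun e : Proj v.T => e.val.1) (h₃ q hq)
  rw [h₄, χ.map_zero'] at hf
  exact Bool.false_ne_true hf

variable [Nontrivial A]

open Classical in
/-- The character defined by an element of `M̄`. -/
noncomputable def char (r : D.Mbar) : Character v.T where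
  val f := decide (v.Dominates r f.val.1)
  map_mul' f g := by
    rw [← Bool.decide_and, decide_eq_decide]
    exact dominates_mul (v.coe_mem_F f) (v.coe_mem_F g)
  map_zero' := decide_eq_false (not_dominates_zero r)
  exists_eq_true := ⟨v.projT 1 1, decide_eq_true (by
    change v.Dominates r (v.proj 1 1)
    rw [proj_one]
    exact dominates_one r)⟩

theorem char_apply {r : D.Mbar} {f : Proj v.T} :
    (v.char r).1 f = true ↔ v.Dominates r f.val.1 := by
  classical
  exact decide_eq_true_iff

theorem char_projT {r : D.Mbar} {m : D.M} {a : D.P} :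
    (v.char r).1 (v.projT m a) = true ↔ r.1 a = m :=
  v.char_apply.trans dominates_proj_iff

theorem char_injective : Function.Injective v.char := by
  intro r r' h
  apply Subtype.ext
  funext a
  obtain ⟨m, hm⟩ := D.exists_rep r' a
  rw [hm, ← v.char_projT, h, v.char_projT, hm]

/-- A character whose support contains that of the character of `r` is equal to it. -/
theorem eq_char_of_forall {χ : Character v.T} {r : D.Mbar}
    (h : ∀ (a : D.P) (m : D.M), r.1 a = m → χ.1 (v.projT m a) = true) : χ = v.char r := by
  apply Character.ext
  funext f
  rw [Bool.eq_iff_iff, v.char_apply]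
  obtain ⟨a, ha⟩ := exists_dominates_iff (v.coe_mem_F f)
  obtain ⟨m, hm⟩ := D.exists_rep r a
  have hχ := χ.map_mul' f (v.projT m a)
  rw [h a m hm, Bool.and_true] at hχ
  rcases ha r m hm with ⟨h₁, h₂⟩ | ⟨h₁, h₂⟩
  · have : f * v.projT m a = v.projT m a := Proj.ext (Subtype.ext h₂)
    rw [this, h a m hm] at hχ
    exact iff_of_true hχ.symm h₁
  · have : f * v.projT m a = 0 := Proj.ext (Subtype.ext h₂)
    rw [this, χ.map_zero'] at hχ
    exact iff_of_false (by rw [← hχ]; simp) h₁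

theorem exists_eq_char {χ : Character v.T} (h : ∀ a, ∃ m, χ.1 (v.projT m a) = true) :
    ∃ r, χ = v.char r := by
  have huniq : ∀ a m n, χ.1 (v.projT m a) = true → χ.1 (v.projT n a) = true →
      (m : D.M ⧸ D.Mₐ a) = n := by
    intro a m n hm hn
    by_contra hmn
    have hχ := χ.map_mul' (v.projT m a) (v.projT n a)
    have : v.projT m a * v.projT n a = 0 := Proj.ext (Subtype.ext (v.proj_mul_of_ne hmn))
    rw [hm, hn, this, χ.map_zero'] at hχ
    exact Bool.false_ne_true hχ
  choose k hk using h
  -- The projection selected at level $ab$ lies under the one with the same representative at level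
  -- $a$; the latter is thus in the support, and orthogonality allows only one coset at each level.
  have hmul : ∀ a b, (k (a * b) : D.M ⧸ D.Mₐ a) = k a := by
    intro a b
    refine huniq a _ _ ?_ (hk a)
    have hχ := χ.map_mul' (v.projT (k (a * b)) a) (v.projT (k (a * b)) (a * b))
    have : v.projT (k (a * b)) a * v.projT (k (a * b)) (a * b) = v.projT (k (a * b)) (a * b) :=
      Proj.ext (Subtype.ext (v.proj_mul_proj rfl))
    rw [this, hk, Bool.and_true] at hχ
    exact hχ.symm
  refine ⟨⟨fun a => k a, fun a b => hmul a b⟩, v.eq_char_of_forall fun a m hm => ?_⟩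
  rw [← v.projT_eq hm]
  exact hk a

theorem char_mem_maximal (r : D.Mbar) : v.char r ∈ Character.maximal v.T :=
  fun _ hy => v.eq_char_of_forall fun _ _ hm => hy _ (v.char_projT.2 hm)

/-- For each $a$, selecting some coset is a finite union of closed conditions on a character. Hence
the closure of the maximal characters still selects at every level, and such characters come from
$\overline M$. -/
theorem tight_eq_range_char : Character.tight v.T = Set.range v.char := by
  apply Set.Subset.antisymm
  · have hc : IsClosed {χ : Character v.T | ∀ a, ∃ m, χ.1 (v.projT m a) = true} := by
      have : {χ : Character v.T | ∀ a, ∃ m, χ.1 (v.projT m a) = true} =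
          ⋂ a, ⋃ q : D.M ⧸ D.Mₐ a, {χ | χ.1 (v.projT q.out a) = true} := by
        ext χ
        simp only [Set.mem_iInter, Set.mem_iUnion, Set.mem_ofPred_eq]
        refine forall_congr' fun a => ⟨?_, fun ⟨q, hq⟩ => ⟨_, hq⟩⟩
        rintro ⟨m, hm⟩
        refine ⟨m, ?_⟩
        rwa [v.projT_eq (QuotientGroup.out_eq' (m : D.M ⧸ D.Mₐ a))]
      rw [this]
      exact isClosed_iInter fun a => isClosed_iUnion_of_finite fun q =>
        Character.isClosed_setOf_apply _
    intro χ hχ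
    obtain ⟨r, rfl⟩ := v.exists_eq_char
      (closure_minimal (fun χ hχ => v.exists_projT_of_mem_maximal hχ) hc hχ)
    exact ⟨r, rfl⟩
  · rintro _ ⟨r, rfl⟩
    exact subset_closure (v.char_mem_maximal r)

/-- The value at $f$ depends only on $r_a$ for a level $a$ adapted to $f$, which gives continuity.
Conversely, the basic open set $r_a=m$ is where the character takes the value $1$ at
$u(m)e_au(m)^{-1}$. -/
theorem isEmbedding_char : Topology.IsEmbedding v.char := by
  refine ⟨⟨le_antisymm ?_ ?_⟩, v.char_injective⟩
  · rw [← continuous_iff_le_induced]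
    refine continuous_induced_rng.2 (continuous_pi fun f => ?_)
    obtain ⟨a, ha⟩ := exists_dominates_iff (v.coe_mem_F f)
    refine IsLocallyConstant.continuous ((IsLocallyConstant.iff_exists_open _).2 fun r => ?_)
    refine ⟨_, D.isOpen_setOf_apply_eq a (r.1 a), rfl, fun r' hr' => ?_⟩
    obtain ⟨m, hm⟩ := D.exists_rep r a
    change (v.char r').1 f = (v.char r).1 f
    rw [Bool.eq_iff_iff, v.char_apply, v.char_apply]
    have hr'm : r'.1 a = m := hr'.trans hm
    rcases ha r m hm with h | h <;> rcases ha r' m hr'm with h' | h'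
    · exact iff_of_true h'.1 h.1
    · exact absurd (h.2.symm.trans h'.2) (v.proj_ne_zero m a)
    · exact absurd (h'.2.symm.trans h.2) (v.proj_ne_zero m a)
    · exact iff_of_false h'.1 h.1
  · intro U hU
    rw [D.isOpen_Mbar_iff] at hU
    refine isOpen_induced_iff.2 ⟨⋃ p : {p : D.M × D.P // ∀ r : D.Mbar, r.1 p.2 = p.1 → r ∈ U},
      {χ | χ.1 (v.projT p.1.1 p.1.2) = true},
      isOpen_iUnion fun p => Character.isOpen_setOf_apply _, ?_⟩
    ext r
    simp only [Set.mem_preimage, Set.mem_iUnion, Set.mem_ofPred_eq, char_projT]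
    constructor
    · rintro ⟨p, hp⟩
      exact p.2 r hp
    · intro hr
      obtain ⟨a, ha⟩ := hU r hr
      obtain ⟨m, hm⟩ := D.exists_rep r a
      exact ⟨⟨(m, a), fun r' hr' => ha r' (hr'.trans hm.symm)⟩, hm⟩

theorem char_mem_dom_ofGroup_iff {r : D.Mbar} {g : D.G} :
    v.char r ∈ Character.dom (v.ofGroup g) ↔ g⁻¹ • D.incl r ∈ Set.range D.incl := by
  have h : v.char r ∈ Character.dom (v.ofGroup g) ↔
      v.Dominates r ((v.ofGroup g).1 * star (v.ofGroup g).1) := v.char_apply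
  rw [h]
  refine ⟨fun h => v.exists_inv_smul_incl_of_dominates h, ?_⟩
  rintro ⟨r', hr'⟩
  have := (v.dominates_conj_ofGroup_iff hr'.symm (f := 1)
    (by rw [← v.proj_one]; exact v.proj_mem_X 1 1)).2 (dominates_one r')
  rwa [mul_one] at this

theorem act_char {r r' : D.Mbar} {g : D.G} (h : v.char r ∈ Character.dom (v.ofGroup g))
    (hr : g⁻¹ • D.incl r = D.incl r') : (v.char r).act (v.ofGroup g) h = v.char r' := by
  apply Character.ext
  funext f
  rw [Bool.eq_iff_iff, v.char_apply, ← v.dominates_conj_ofGroup_iff hr (v.coe_mem_F f).2]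
  exact v.char_apply

end CuntzLiFamily

end CuntzLiPair

/-! ### Equality and products of germs. -/

namespace InverseSemigroupWithZero

variable {S : Type*} [InverseSemigroupWithZero S]

theorem Character.isOpen_dom (s : S) : IsOpen (Character.dom s) :=
  Character.isOpen_setOf_apply _

namespace Germ

open Character

theorem mk_congr {x y : Character S} {s t : S} (hs : x ∈ dom s) (hxy : x = y) (hst : s = t) :
    mk x s hs = mk y t (hxy ▸ hst ▸ hs) := by
  subst hxy hst
  rfl

theorem comp_mk_of_eq {x y : Character S} {s t : S} {hs : x ∈ dom s} {ht : y ∈ dom t}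
    (hy : x.act s hs = y) (hc : src (mk x s hs) = rng (mk y t ht)) :
    comp (mk x s hs) (mk y t ht) hc = mk x (s * t) (mem_dom_mul hs (hy ▸ ht)) := by
  subst hy
  exact comp_mk x s t hs ht hc

theorem mk_eq_mk_iff {x y : Character S} {s t : S} {hs : x ∈ dom s} {ht : y ∈ dom t} :
    mk x s hs = mk y t ht ↔ x = y ∧ ∃ e : Proj S, x.1 e = true ∧ e.1 * s = e.1 * t :=
  ⟨fun h => Quotient.exact h, fun h => Quotient.sound h⟩

end Germ

end InverseSemigroupWithZero

/-! ### The isomorphism of groupoids. -/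

namespace CuntzLiPair

variable {N H : Type*} [Group N] [Group H] {D : CuntzLiPair N H}

namespace CuntzLiFamily

open InverseSemigroupWithZero

variable {A : Type*} [CStarAlgebra A] [Nontrivial A] (v : D.CuntzLiFamily A)

/-- The homeomorphism from `M̄`, as a subspace of `N̄`, to the space of tight characters. -/
noncomputable def unitsHomeomorph : Set.range D.incl ≃ₜ Character.tight v.T :=
  D.isOpenEmbedding_incl.isEmbedding.toHomeomorph.symm.trans
    (v.isEmbedding_char.toHomeomorph.trans (Homeomorph.setCongr v.tight_eq_range_char.symm))

theorem coe_unitsHomeomorph {x : Set.range D.incl} {r : D.Mbar} (h : D.incl r = x.1) :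
    (v.unitsHomeomorph x).1 = v.char r := by
  have : D.isOpenEmbedding_incl.isEmbedding.toHomeomorph.symm x = r :=
    (Homeomorph.symm_apply_eq _).2 (Subtype.ext h.symm)
  change v.char (D.isOpenEmbedding_incl.isEmbedding.toHomeomorph.symm x) = _
  rw [this]

theorem unitsHomeomorph_mem_dom (γ : D.RestrictedGroupoid) :
    (v.unitsHomeomorph ⟨γ.arrow.pt, γ.rng_mem⟩).1 ∈ Character.dom (v.ofGroup γ.arrow.elt) := by
  obtain ⟨r, hr⟩ : ∃ r, D.incl r = γ.arrow.pt := γ.rng_mem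
  rw [v.coe_unitsHomeomorph hr, char_mem_dom_ofGroup_iff, hr]
  exact γ.src_mem

theorem act_unitsHomeomorph (γ : D.RestrictedGroupoid) :
    (v.unitsHomeomorph ⟨γ.arrow.pt, γ.rng_mem⟩).1.act (v.ofGroup γ.arrow.elt)
      (v.unitsHomeomorph_mem_dom γ) =
        (v.unitsHomeomorph ⟨γ.arrow.elt⁻¹ • γ.arrow.pt, γ.src_mem⟩).1 := by
  obtain ⟨r, hr⟩ : ∃ r, D.incl r = γ.arrow.pt := γ.rng_mem
  obtain ⟨r', hr'⟩ : ∃ r, D.incl r = γ.arrow.elt⁻¹ • γ.arrow.pt := γ.src_mem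
  have hd := v.unitsHomeomorph_mem_dom γ
  rw [v.coe_unitsHomeomorph hr] at hd
  refine Eq.trans ?_ ((v.act_char hd (by rw [hr, hr'])).trans (v.coe_unitsHomeomorph hr').symm)
  congr 1
  exact v.coe_unitsHomeomorph hr

/-- The map `(x, a⁻¹ m b) ↦ [(x, s_a* u(m) s_b)]`. -/
noncomputable def toTightGroupoid (γ : D.RestrictedGroupoid) : TightGroupoid v.T where
  arrow := Germ.mk (v.unitsHomeomorph ⟨γ.arrow.pt, γ.rng_mem⟩).1 (v.ofGroup γ.arrow.elt)
    (v.unitsHomeomorph_mem_dom γ)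
  rng_mem := (v.unitsHomeomorph ⟨γ.arrow.pt, γ.rng_mem⟩).2
  src_mem := by
    have := v.act_unitsHomeomorph γ
    change (v.unitsHomeomorph ⟨γ.arrow.pt, γ.rng_mem⟩).1.act (v.ofGroup γ.arrow.elt)
      (v.unitsHomeomorph_mem_dom γ) ∈ _
    rw [this]
    exact (v.unitsHomeomorph _).2

/-- Write $t=ft_g$. Then $tt^*$ lies below both $f$ and $t_gt_g^*$, so a character defined on $t$
takes the value $1$ at both. Thus $f$ itself witnesses that $t$ and $t_g$ have the same germ. -/
theorem toTightGroupoid_surjective : Function.Surjective v.toTightGroupoid := by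
  rintro ⟨δ, hδ, hδ'⟩
  obtain ⟨χ, t, ht, rfl⟩ := Germ.exists_rep δ
  have hχ : χ ∈ Character.tight v.T := hδ
  obtain ⟨x, hx⟩ := v.unitsHomeomorph.surjective ⟨χ, hχ⟩
  obtain ⟨g, f, hf, hfg⟩ := v.exists_eq_mul_ofGroup t
  have htf : (v.toProj f hf).val * v.ofGroup g = t := Subtype.ext hfg.symm
  have hft : (v.toProj f hf).val * t = t := by
    rw [← htf, ← mul_assoc]
    congr 1
    exact (v.toProj f hf).2.isIdempotentElem
  have h₁ : χ.1 (v.toProj f hf) = true := by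
    have h := χ.map_mul' (v.toProj f hf) (Proj.final t)
    have e : v.toProj f hf * Proj.final t = Proj.final t := by
      apply Proj.ext
      change (v.toProj f hf).val * (t * star t) = t * star t
      rw [← mul_assoc, hft]
    rw [e, show χ.1 (Proj.final t) = true from ht, Bool.and_true] at h
    exact h.symm
  have h₂ : χ ∈ Character.dom (v.ofGroup g) := by
    have h := χ.map_mul' (Proj.final t) (Proj.final (v.ofGroup g))
    have e : Proj.final t * Proj.final (v.ofGroup g) = Proj.final t := by
      rw [mul_comm]
      apply Proj.ext
      change v.ofGroup g * star (v.ofGroup g) * (t * star t) = t * star t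
      have hc : v.ofGroup g * star (v.ofGroup g) * (v.toProj f hf).val =
          (v.toProj f hf).val * (v.ofGroup g * star (v.ofGroup g)) :=
        proj_comm (Proj.final (v.ofGroup g)).2 (v.toProj f hf).2
      rw [← mul_assoc]
      congr 1
      conv_lhs => rw [← htf]
      rw [← mul_assoc, hc, mul_assoc, InverseSemigroupWithZero.mul_star_mul_self, htf]
    rw [e, show χ.1 (Proj.final t) = true from ht, Bool.true_and] at h
    exact h.symm
  have hx' : (v.unitsHomeomorph x).1 = χ := congrArg Subtype.val hx
  obtain ⟨r, hr⟩ : ∃ r, D.incl r = x.1 := x.2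
  have hs : g⁻¹ • x.1 ∈ Set.range D.incl := by
    rwa [← hx', v.coe_unitsHomeomorph hr, char_mem_dom_ofGroup_iff, hr] at h₂
  refine ⟨⟨⟨x.1, g⟩, x.2, hs⟩, Reduction.ext ?_⟩
  refine Germ.mk_eq_mk_iff.2 ⟨hx', v.toProj f hf, ?_, ?_⟩
  · change (v.unitsHomeomorph x).1.1 _ = true
    rw [hx', h₁]
  · rw [hft]
    exact htf

/-- Nearby arrows have the same group element, and a projection $e$ witnessing an equality of germs
at one character does so at all characters with value $1$ at $e$, an open set. -/
theorem continuous_toTightGroupoid : Continuous v.toTightGroupoid := by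
  refine Reduction.continuous_iff.2 (continuous_generateFrom_iff.2 ?_)
  rintro _ ⟨s, U, hUs, hU, rfl⟩
  rw [isOpen_iff_forall_mem_open]
  rintro γ ⟨χ, hχ, h⟩
  obtain ⟨rfl, e, he, heq⟩ := Germ.mk_eq_mk_iff.1 h
  have hpt : Continuous fun γ' : D.RestrictedGroupoid =>
      (v.unitsHomeomorph ⟨γ'.arrow.pt, γ'.rng_mem⟩).1 :=
    continuous_subtype_val.comp (v.unitsHomeomorph.continuous.comp
      ((TransformationGroupoid.continuous_pt.comp Reduction.continuous_arrow).subtype_mk _))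
  have helt : IsOpen {γ' : D.RestrictedGroupoid | γ'.arrow.elt = γ.arrow.elt} :=
    (TransformationGroupoid.isLocallyConstant_elt.isOpen_fiber γ.arrow.elt).preimage
      Reduction.continuous_arrow
  refine ⟨_, ?_, ((hU.inter (Character.isOpen_setOf_apply e)).preimage hpt).inter helt,
    ⟨⟨hχ, he⟩, rfl⟩⟩
  rintro γ' ⟨⟨hγU, hγe⟩, hγ⟩
  refine ⟨_, hγU, Germ.mk_eq_mk_iff.2 ⟨rfl, e, hγe, ?_⟩⟩
  rw [show γ'.arrow.elt = γ.arrow.elt from hγ, heq]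

/-- On arrows with fixed $g$ the map is the homeomorphism of units followed by
$\chi\mapsto[(\chi,t_g)]$, and the germs of $t_g$ over an open set of characters are open by
definition of the topology. -/
theorem isOpenMap_toTightGroupoid : IsOpenMap v.toTightGroupoid := by
  rintro _ ⟨_, ⟨O, hO, rfl⟩, rfl⟩
  rw [isOpen_iff_forall_mem_open]
  rintro _ ⟨γ, hγ, rfl⟩
  set g := γ.arrow.elt with hg
  have hOg : IsOpen {x : Set.range D.incl | (x.1, g) ∈ O} :=
    let _ : TopologicalSpace D.G := ⊥
    hO.preimage (continuous_subtype_val.prodMk continuous_const)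
  obtain ⟨U, hU, hUO⟩ := v.unitsHomeomorph.isOpenMap _ hOg
  have hθ : IsOpen {δ : Germ v.T | ∃ (χ : Character v.T)
      (h : χ ∈ U ∩ Character.dom (v.ofGroup g)), δ = Germ.mk χ (v.ofGroup g) h.2} :=
    TopologicalSpace.isOpen_generateFrom_of_mem ⟨_, _, Set.inter_subset_right,
      hU.inter (Character.isOpen_dom _), rfl⟩
  refine ⟨_, ?_, hθ.preimage Reduction.continuous_arrow, ?_⟩
  · rintro ⟨_, hδ, hδ'⟩ ⟨χ, ⟨hχU, hχ⟩, rfl⟩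
    obtain ⟨x, hx, hxχ⟩ : (⟨χ, hδ⟩ : Character.tight v.T) ∈
        v.unitsHomeomorph '' {x : Set.range D.incl | (x.1, g) ∈ O} := by
      rw [← hUO]; exact hχU
    have hx' : (v.unitsHomeomorph x).1 = χ := congrArg Subtype.val hxχ
    obtain ⟨r, hr⟩ : ∃ r, D.incl r = x.1 := x.2
    have hs : g⁻¹ • x.1 ∈ Set.range D.incl := by
      rwa [← hx', v.coe_unitsHomeomorph hr, char_mem_dom_ofGroup_iff, hr] at hχ
    exact ⟨⟨⟨x.1, g⟩, x.2, hs⟩, hx, Reduction.ext (Germ.mk_congr _ hx' rfl)⟩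
  · refine ⟨_, ⟨?_, v.unitsHomeomorph_mem_dom γ⟩, rfl⟩
    have : v.unitsHomeomorph ⟨γ.arrow.pt, γ.rng_mem⟩ ∈
        v.unitsHomeomorph '' {x : Set.range D.incl | (x.1, g) ∈ O} := ⟨_, hγ, rfl⟩
    rwa [← hUO] at this

/-- Injectivity is assumed because the family is arbitrary here: in a general realization the germ
of $t_g$ need not determine $g$. -/
theorem isTopologicalGroupoidIso_toTightGroupoid
    (hinj : Function.Injective v.toTightGroupoid) :
    IsTopologicalGroupoidIso v.toTightGroupoid v.unitsHomeomorph where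
  isHomeomorph := ⟨v.continuous_toTightGroupoid, v.isOpenMap_toTightGroupoid, hinj,
    v.toTightGroupoid_surjective⟩
  isHomeomorph_units := v.unitsHomeomorph.isHomeomorph
  map_rng _ := rfl
  map_src γ := Subtype.ext (v.act_unitsHomeomorph γ)
  map_one x := by
    refine Reduction.ext ?_
    have h : (v.unitsHomeomorph x).1.1 (v.toProj 1 (v.proj_one ▸ v.proj_mem_F 1 1)) = true := by
      obtain ⟨r, hr⟩ : ∃ r, D.incl r = x.1 := x.2
      rw [v.coe_unitsHomeomorph hr, char_apply]
      exact dominates_one r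
    refine Eq.trans ?_ (Germ.one_eq _ _ h).symm
    exact Germ.mk_congr _ rfl (Subtype.ext v.coe_ofGroup_one)
  map_inv γ := Reduction.ext
    (Germ.mk_congr _ (v.act_unitsHomeomorph γ).symm (v.ofGroup_inv _))
  map_comp γ γ' hc hc' := by
    refine Reduction.ext ?_
    have hx : (v.unitsHomeomorph ⟨γ.arrow.pt, γ.rng_mem⟩).1.act (v.ofGroup γ.arrow.elt)
        (v.unitsHomeomorph_mem_dom γ) = (v.unitsHomeomorph ⟨γ'.arrow.pt, γ'.rng_mem⟩).1 :=
      congrArg Subtype.val hc'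
    refine Eq.trans ?_ (Germ.comp_mk_of_eq hx (congrArg Subtype.val hc')).symm
    -- Only the restriction of $t_{gh}$ to $t_gt_g^*$ is $t_gt_h$. This projection has value $1$ at
    -- the range, so the germs agree.
    refine Germ.mk_eq_mk_iff.2 ⟨rfl, Proj.final (v.ofGroup γ.arrow.elt),
      v.unitsHomeomorph_mem_dom γ, ?_⟩
    change v.ofGroup γ.arrow.elt * star (v.ofGroup γ.arrow.elt) *
      v.ofGroup (γ.arrow.elt * γ'.arrow.elt) = v.ofGroup γ.arrow.elt *
        star (v.ofGroup γ.arrow.elt) * (v.ofGroup γ.arrow.elt * v.ofGroup γ'.arrow.elt)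
    rw [ofGroup_mul, ← mul_assoc (v.ofGroup γ.arrow.elt * star (v.ofGroup γ.arrow.elt)),
      InverseSemigroupWithZero.mul_star_mul_self]

end CuntzLiFamily

-- Equal germs give $et_g=et_{g'}$ for some $e$ in the support of $r$. Below $e$ and $t_gt_g^*$
-- there is a projection selected by $r$, and on it the regular representation separates $g$ from
-- $g'$.
open InverseSemigroupWithZero in
theorem toTightGroupoid_injective (D : CuntzLiPair N H) :
    Function.Injective D.universalFamily.toTightGroupoid := by
  intro γ γ' h
  set v := D.universalFamily
  obtain ⟨hx, e, he, heq⟩ := Germ.mk_eq_mk_iff.1 (congrArg Reduction.arrow h)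
  obtain ⟨r, hr⟩ : ∃ r, D.incl r = γ.arrow.pt := γ.rng_mem
  have hd := v.unitsHomeomorph_mem_dom γ
  have hpt : γ.arrow.pt = γ'.arrow.pt :=
    congrArg Subtype.val (v.unitsHomeomorph.injective (Subtype.ext hx))
  rw [v.coe_unitsHomeomorph hr] at he hd
  refine Reduction.ext (TransformationGroupoid.ext hpt ?_)
  obtain ⟨a, m, b, hg⟩ := D.exists_word γ.arrow.elt
  obtain ⟨a', m', b', hg'⟩ := D.exists_word γ'.arrow.elt
  rw [hg, CuntzLiFamily.ofGroup_word] at heq hd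
  rw [hg', CuntzLiFamily.ofGroup_word] at heq
  rw [hg, hg']
  have he' : v.Dominates r e.val.1 := v.char_apply.1 he
  have hd' : v.Dominates r ((v.elt a m b).1 * star (v.elt a m b).1) := v.char_apply.1 hd
  obtain ⟨c, k, hk, hek⟩ := he'
  obtain ⟨d, l, hl, hdl⟩ := hd'
  -- A common refinement of the levels at which $e$ and $t_gt_g^*$ dominate a projection selected by
  -- $r$.
  obtain ⟨α, β, hαβ⟩ := D.left_reversible c d
  obtain ⟨n, hn⟩ := D.exists_rep r (c * α)
  have h₁ := CuntzLiFamily.mul_proj_eq_of_mul_proj_eq hk hek hn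
  rw [hαβ] at hn h₁
  have h₂ := CuntzLiFamily.mul_proj_eq_of_mul_proj_eq hl hdl hn
  refine D.word_eq_word_of_star_mul_proj_eq h₂ ?_
  have h₃ : star (v.elt a m b).1 * e.val.1 = star (v.elt a' m' b').1 * e.val.1 := by
    have := congrArg (fun t : D.T => star t.1) heq
    simp only [CuntzLiFamily.coe_mul, star_mul] at this
    rwa [(v.coe_mem_F e).1.isSelfAdjoint.star_eq] at this
  rw [← h₁, ← mul_assoc, h₃, mul_assoc]

end CuntzLiPair

theorem mainTheorem1 {N H : Type*} [Group N] [Group H] (D : CuntzLiPair N H) :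
    IsTopologicalGroupoid D.RestrictedGroupoid ∧
    IsTopologicalGroupoid (InverseSemigroupWithZero.TightGroupoid D.T) ∧
    (∀ g : D.G, ∃ (a : D.P) (m : D.M) (b : D.P), g = D.word a m b) ∧
    ∃ (φ : D.RestrictedGroupoid → InverseSemigroupWithZero.TightGroupoid D.T)
      (φ₀ : Set.range D.incl → InverseSemigroupWithZero.Character.tight D.T),
      IsTopologicalGroupoidIso φ φ₀ ∧
      ∀ (γ : D.RestrictedGroupoid) (x : D.Mbar) (a : D.P) (m : D.M) (b : D.P),
        γ.arrow = ⟨D.incl x, D.word a m b⟩ →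
          ∃ (χ : InverseSemigroupWithZero.Character D.T)
            (h : χ ∈ InverseSemigroupWithZero.Character.dom (D.universalFamily.elt a m b)),
            D.IsCharacterOf x χ ∧
              (φ γ).arrow =
                InverseSemigroupWithZero.Germ.mk χ (D.universalFamily.elt a m b) h := by
  have hφ := D.universalFamily.isTopologicalGroupoidIso_toTightGroupoid
    D.toTightGroupoid_injective
  have hG : IsTopologicalGroupoid D.RestrictedGroupoid :=
    TransformationGroupoid.isTopologicalGroupoid.reduction _
  -- Continuity of the operations on germs is transported along the isomorphism from the restricted
  -- transformation groupoid.
  refine ⟨hG, hφ.isTopologicalGroupoid hG, D.exists_word, _, _, hφ, ?_⟩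
  rintro ⟨_, h₁, h₂⟩ x a m b rfl
  refine ⟨D.universalFamily.char x, ?_, fun f => D.universalFamily.char_apply, ?_⟩
  · rw [← CuntzLiPair.CuntzLiFamily.ofGroup_word]
    exact D.universalFamily.char_mem_dom_ofGroup_iff.2 h₂
  · exact InverseSemigroupWithZero.Germ.mk_congr _
      (D.universalFamily.coe_unitsHomeomorph rfl) (D.universalFamily.ofGroup_word a m b)
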